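/- All groups are finite and representations are finite-dimensional and complex. Write $L(X)$ for the space of complex functions on a finite set $X$; the permutation representation of $G$ on $L(X)$ is $[gf](x)=f(g^{-1}x)$. For $S\le G$ and a representation $(\sigma,V)$ of $S$, $\mathrm{Ind}_S^G\sigma$ acts by $[gf](x)=f(g^{-1}x)$ on the functions $f\colon G\to V$ with $f(gs)=\sigma(s^{-1})f(g)$; $\iota_S$ is the trivial representation and $\sim$ denotes equivalence. The multiplicity of an irreducible $\rho$ in $\tau$ is $\dim\mathrm{Hom}_G(\rho,\tau)$. **Setting.** Let $H$ be a finite group acting by automorphisms on a finite abelian group $A$, and let $H\ltimes A$ have the product $(h,a)(h',a')=(hh',a+ha')$. Let $H$ act transitively on a set $Y$, let $(B_y)_{y\in Y}$ be abelian groups, with isomorphisms $h\colon B_y\to B_{hy}$ satisfying $(hh')b=h(h'b)$ and $1_Hb=b$, and surjective homomorphisms $\pi_y\colon A\to B_y$ with $h\,\pi_y(a)=\pi_{hy}(ha)$. Then $H\ltimes A$ acts on $X=\{(y,b)\colon y\in Y,\ b\in B_y\}$ by $(h,a)(y,b)=(hy,\pi_{hy}(a)+hb)$. Fix $y_0\in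 Y$, let $K$ be its stabilizer in $H$, $B=B_{y_0}$, $\pi=\pi_{y_0}$ and $C=\mathrm{Ker}\,\pi$; so $B\cong A/C$ and $X\cong(H\ltimes A)/(K\ltimes C)$. For $\psi\in\widehat A$ and $h\in H$ let ${}^h\psi(a)=\psi(h^{-1}a)$; for $\theta\in\widehat B$ and $k\in K$ let ${}^k\theta(b)=\theta(k^{-1}b)$. Let $\overset{\triangle}{\theta}=\theta\circ\pi\in\widehat A$, $H_\theta=\{h\in H\colon{}^h\overset{\triangle}{\theta}=\overset{\triangle}{\theta}\}$ and $K_\theta=H_\theta\cap K$. For a representation $\sigma$ of $H_\theta$, let $\widetilde{\overline\theta}\otimes\overset{\triangle}{\sigma}$ be the representation $(h,a)\mapsto\overline{\theta(\pi(a))}\,\sigma(h)$ of $H_\theta\ltimes A$. For $h\in H$ let ${}^h\sigma(s)=\sigma(h^{-1}sh)$, a representation of $hH_\theta h^{-1}$. Let $\Theta\subseteq\widehat B$ be a complete set of representatives of the $K$-orbits on $\widehat B$, and let $\Xi\subseteq\Theta$ be such that $\{\overset{\triangle}{\xi}\colon\xi\in\Xi\}$ is a complete set of representatives (one $\xi$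 per orbit) of the $H$-orbits on $\widehat A$ that contain a character of the form $\overset{\triangle}{\chi}$, $\chi\in\widehat B$. For $\xi\in\Xi$ put $$[\xi]=\bigl\{\theta\in\Theta\colon\{{}^k\overset{\triangle}{\theta}\colon k\in K\}\subseteq\{{}^h\overset{\triangle}{\xi}\colon h\in H\}\bigr\}.$$ For $\theta\in\Theta$ let $L(H_\theta/K_\theta)\sim\bigoplus_{j=0}^{n_\theta}m_{\theta,j}\,\sigma_{\theta,j}$ be the decomposition of the permutation representation of $H_\theta$, where the $\sigma_{\theta,j}$ are irreducible and pairwise inequivalent, the $m_{\theta,j}$ are positive integers, and $\sigma_{\theta,0}$ is trivial. **Theorem.** The permutation representation of $H\ltimes A$ on $L(X)$ is equivalent to $\mathrm{Ind}_{K\ltimes C}^{H\ltimes A}\iota_{K\ltimes C}$, and $$\mathrm{Ind}_{K\ltimes C}^{H\ltimes A}\iota_{K\ltimes C}\sim\bigoplus_{\theta\in\Theta}\bigoplus_{j=0}^{n_\theta}m_{\theta,j}\,\mathrm{Ind}_{H_\theta\ltimes A}^{H\ltimes A}\bigl(\widetilde{\overline\theta}\otimes\overset{\triangle}{\sigma_{\theta,j}}\bigr),$$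 where all the summands on the right are irreducible. Moreover, if $\xi\in\Xi$ and $\sigma$ is an irreducible representation of $H_\xi$, then $\mathrm{Ind}_{H_\xi\ltimes A}^{H\ltimes A}(\widetilde{\overline\xi}\otimes\overset{\triangle}{\sigma})$ is irreducible and its multiplicity in $L(X)$ equals $$\sum m_{\theta,j},$$ the sum being over all pairs $(\theta,j)$, $\theta\in\Theta$, $0\le j\le n_\theta$, for which there is $h\in H$ with ${}^h\overset{\triangle}{\xi}=\overset{\triangle}{\theta}$ and ${}^h\sigma\sim\sigma_{\theta,j}$. In particular, the multiplicity of $\mathrm{Ind}_{H_\xi\ltimes A}^{H\ltimes A}(\widetilde{\overline\xi}\otimes\overset{\triangle}{\iota_{H_\xi}})$ equals $|[\xi]|$. -/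

import Mathlib

noncomputable section

namespace SemidirectPerm

/-! ### Generalities on complex representations -/

section Generalities

variable {G : Type*} [Group G]

/-- The permutation representation of `G` on `L(X) = (X → ℂ)`: `[g f](x) = f (g⁻¹ x)`. -/
def permRep (G X : Type*) [Group G] [MulAction G X] : Representation ℂ G (X → ℂ) where
  toFun g := LinearMap.funLeft ℂ ℂ (fun x : X => g⁻¹ • x)
  map_one' := by
    ext f x
    simp [LinearMap.funLeft_apply]
  map_mul' g h := by
    apply LinearMap.ext
    intro f
    funext x
    simp [LinearMap.funLeft_apply, mul_smul]

/-- The space of the representation of `G` induced by a representation `σ` of a subgroup `S`: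
all `f : G → V` with `f (g s) = σ(s⁻¹) f(g)`. -/
def inducedSpace (S : Subgroup G) {V : Type*} [AddCommGroup V] [Module ℂ V]
    (σ : Representation ℂ S V) : Submodule ℂ (G → V) where
  carrier := {f | ∀ (g : G) (s : S), f (g * s) = σ s⁻¹ (f g)}
  zero_mem' := by
    intro g s
    simp
  add_mem' := by
    intro f₁ f₂ h₁ h₂ g s
    simp [h₁ g s, h₂ g s]
  smul_mem' := by
    intro c f h g s
    simp [h g s]

/-- The induced representation `Ind_S^G σ`: `[g f](x) = f (g⁻¹ x)`. -/
def induced (S : Subgroup G) {V : Type*} [AddCommGroup V] [Module ℂ V]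
    (σ : Representation ℂ S V) : Representation ℂ G (inducedSpace S σ) where
  toFun g := (LinearMap.funLeft ℂ V (fun x : G => g⁻¹ * x)).restrict (by
    intro f hf x s
    simpa [LinearMap.funLeft_apply, mul_assoc] using hf (g⁻¹ * x) s)
  map_one' := by
    apply LinearMap.ext
    intro f
    apply Subtype.ext
    funext x
    simp [LinearMap.funLeft_apply]
  map_mul' g h := by
    apply LinearMap.ext
    intro f
    apply Subtype.ext
    funext x
    change (f : G → V) ((g * h)⁻¹ * x) = (f : G → V) (h⁻¹ * (g⁻¹ * x))
    rw [mul_inv_rev, mul_assoc]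

/-- Equivalence `ρ ∼ τ` of representations. -/
def Equivalent {V W : Type*} [AddCommMonoid V] [Module ℂ V] [AddCommMonoid W] [Module ℂ W]
    (ρ : Representation ℂ G V) (τ : Representation ℂ G W) : Prop :=
  Nonempty (ρ.Equiv τ)

/-- The multiplicity of an irreducible representation `ρ` in `τ`: the dimension of `Hom_G(ρ, τ)`. -/
def multiplicity {V W : Type*} [AddCommGroup V] [Module ℂ V] [AddCommGroup W] [Module ℂ W]
    (ρ : Representation ℂ G V) (τ : Representation ℂ G W) : ℕ :=
  Module.finrank ℂ (Representation.IntertwiningMap ρ τ)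

/-- The conjugate `ᵍσ` of a representation `σ` of `S`, as a representation of `T = g S g⁻¹`:
`[ᵍσ](t) = σ (g⁻¹ t g)`. -/
def conjRep (g : G) {S T : Subgroup G} (hT : T = S.map (MulAut.conj g).toMonoidHom)
    {V : Type*} [AddCommGroup V] [Module ℂ V] (σ : Representation ℂ S V) :
    Representation ℂ T V :=
  MonoidHom.comp σ (MonoidHom.mk' (fun t : T => (⟨g⁻¹ * t * g, by
    obtain ⟨t, ht⟩ := t
    subst hT
    obtain ⟨s, hs, rfl⟩ := ht
    simpa [mul_assoc] using hs⟩ : S)) (by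
      intro a b
      apply Subtype.ext
      simp [mul_assoc]))

end Generalities

/-! ### The semidirect product and characters -/

section Semidirect

variable {H A : Type*} [Group H] [AddCommGroup A] [DistribMulAction H A]

/-- The action of `H` on `A` by automorphisms, with `A` written multiplicatively. -/
def actionHom (H A : Type*) [Group H] [AddCommGroup A] [DistribMulAction H A] :
    H →* MulAut (Multiplicative A) :=
  (MulAutMultiplicative A).symm.toMonoidHom.comp (DistribMulAction.toAddAut H A)

/-- The semidirect product `H ⋉ A`, with `(h, a) (h', a') = (h h', a + h a')`. The component in `H`
is `right`, the component in `A` is `left`. -/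
abbrev SDP (H A : Type*) [Group H] [AddCommGroup A] [DistribMulAction H A] : Type _ :=
  SemidirectProduct (Multiplicative A) H (actionHom H A)

/-- The component in `A` of an element of `H ⋉ A`. -/
def SDP.vec (g : SDP H A) : A := g.left.toAdd

@[simp] theorem SDP.vec_one : (1 : SDP H A).vec = 0 := rfl

@[simp] theorem SDP.vec_mul (g g' : SDP H A) : (g * g').vec = g.vec + g.right • g'.vec := rfl

@[simp] theorem SDP.vec_inv (g : SDP H A) : (g⁻¹).vec = -(g.right⁻¹ • g.vec) := by
  rw [← smul_neg]
  rfl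

/-- The subgroup `K ⋉ C` of `H ⋉ A`, for `K ≤ H` and a `K`-invariant `C ≤ A`. -/
def sdpSubgroup (K : Subgroup H) (C : AddSubgroup A) (hC : ∀ k ∈ K, ∀ c ∈ C, k • c ∈ C) :
    Subgroup (SDP H A) where
  carrier := {g | g.right ∈ K ∧ g.vec ∈ C}
  one_mem' := by
    exact ⟨K.one_mem, C.zero_mem⟩
  mul_mem' := by
    intro a b ha hb
    exact ⟨K.mul_mem ha.1 hb.1, by
      simpa using C.add_mem ha.2 (hC _ ha.1 _ hb.2)⟩
  inv_mem' := by
    intro a ha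
    exact ⟨K.inv_mem ha.1, by
      simpa using hC _ (K.inv_mem ha.1) _ ha.2⟩

/-- The subgroup `J ⋉ A` of `H ⋉ A`, for `J ≤ H`. -/
abbrev sdpFull (A : Type*) [AddCommGroup A] [DistribMulAction H A] (J : Subgroup H) :
    Subgroup (SDP H A) :=
  sdpSubgroup J (⊤ : AddSubgroup A) (fun _ _ _ _ => AddSubgroup.mem_top _)

/-- The conjugate `ʰψ` of a character `ψ` of `A`: `ʰψ(a) = ψ(h⁻¹ a)`. -/
def charConj (h : H) (ψ : AddChar A Circle) : AddChar A Circle :=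
  ψ.compAddMonoidHom (DistribSMul.toAddMonoidHom A h⁻¹)

@[simp] theorem charConj_apply (h : H) (ψ : AddChar A Circle) (a : A) :
    charConj h ψ a = ψ (h⁻¹ • a) := rfl

theorem charConj_one (ψ : AddChar A Circle) : charConj (1 : H) ψ = ψ := by
  ext a
  simp

theorem charConj_mul (h h' : H) (ψ : AddChar A Circle) :
    charConj (h * h') ψ = charConj h (charConj h' ψ) := by
  ext a
  simp [mul_smul]

/-- The stabilizer `H_ψ` of a character `ψ` of `A`. -/
def charStab (H : Type*) {A : Type*} [Group H] [AddCommGroup A] [DistribMulAction H A]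
    (ψ : AddChar A Circle) : Subgroup H where
  carrier := {h | charConj h ψ = ψ}
  one_mem' := charConj_one ψ
  mul_mem' := by
    intro a b ha hb
    change charConj (a * b) ψ = ψ
    rw [charConj_mul, show charConj b ψ = ψ from hb, show charConj a ψ = ψ from ha]
  inv_mem' := by
    intro a ha
    change charConj a⁻¹ ψ = ψ
    conv_lhs => rw [← show charConj a ψ = ψ from ha]
    rw [← charConj_mul, inv_mul_cancel, charConj_one]

theorem mem_charStab {ψ : AddChar A Circle} {h : H} :
    h ∈ charStab H ψ ↔ charConj h ψ = ψ := Iff.rfl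

/-- `H_φ = h H_ψ h⁻¹` when `φ = ʰψ`. -/
theorem charStab_conj {h : H} {ψ φ : AddChar A Circle} (e : charConj h ψ = φ) :
    charStab H φ = (charStab H ψ).map (MulAut.conj h).toMonoidHom := by
  subst e
  ext t
  constructor
  · intro ht
    refine ⟨h⁻¹ * t * h, ?_, by simp [mul_assoc]⟩
    change charConj (h⁻¹ * t * h) ψ = ψ
    rw [charConj_mul, charConj_mul, show charConj t (charConj h ψ) = charConj h ψ from ht,
      ← charConj_mul, inv_mul_cancel, charConj_one]
  · rintro ⟨s, hs, rfl⟩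
    change charConj (h * s * h⁻¹) (charConj h ψ) = charConj h ψ
    rw [← charConj_mul, inv_mul_cancel_right, charConj_mul, show charConj s ψ = ψ from hs]

/-- The conjugate character `ψ̄`. -/
def charBar {M : Type*} [AddCommGroup M] (ψ : AddChar M Circle) : AddChar M Circle := ψ⁻¹

theorem coe_charBar {M : Type*} [AddCommGroup M] (ψ : AddChar M Circle) (a : M) :
    (charBar ψ a : ℂ) = (starRingEnd ℂ) (ψ a : ℂ) := by
  rw [charBar, AddChar.inv_apply', Circle.coe_inv_eq_conj]

theorem charStab_charBar (ψ : AddChar A Circle) : charStab H (charBar ψ) = charStab H ψ := by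
  ext h
  rw [mem_charStab, mem_charStab, ← inv_inj (a := charConj h (charBar ψ))]
  have h1 : (charConj h (charBar ψ))⁻¹ = charConj h ψ := by
    ext a
    simp [charBar]
  rw [h1, charBar, inv_inv]

/-- The representation `ψ̃ ⊗ σ^△` of `J ⋉ A` for a subgroup `J` of the stabilizer of `ψ` and a
representation `σ` of `J`: `(h, a) ↦ ψ(a) σ(h)`. -/
def extTensor (ψ : AddChar A Circle) (J : Subgroup H) (hJ : J ≤ charStab H ψ)
    {V : Type*} [AddCommGroup V] [Module ℂ V] (σ : Representation ℂ J V) :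
    Representation ℂ (sdpFull A J) V where
  toFun g := (ψ g.1.vec : ℂ) • σ ⟨g.1.right, g.2.1⟩
  map_one' := by
    have h1 : (⟨(1 : sdpFull A J).1.right, (1 : sdpFull A J).2.1⟩ : J) = 1 := rfl
    rw [h1, map_one]
    simp
  map_mul' g g' := by
    have h1 : (⟨(g * g').1.right, (g * g').2.1⟩ : J)
        = ⟨g.1.right, g.2.1⟩ * ⟨g'.1.right, g'.2.1⟩ := rfl
    have h2 : ψ (g.1.right • g'.1.vec) = ψ g'.1.vec := by
      have h3 := DFunLike.congr_fun (hJ (J.inv_mem g.2.1)) g'.1.vec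
      simpa using h3
    rw [h1, map_mul]
    simp [AddChar.map_add_eq_mul, h2, smul_smul, mul_comm]

/-- The representation `Ind_{H_ψ ⋉ A}^{H ⋉ A} (ψ̄̃ ⊗ σ^△)` of `H ⋉ A`, for a representation
`σ` of `H_ψ` (which is also the stabilizer of `ψ̄`). -/
def littleGroupRep (ψ : AddChar A Circle)
    {V : Type*} [AddCommGroup V] [Module ℂ V] (σ : Representation ℂ (charStab H ψ) V) :
    Representation ℂ (SDP H A) (inducedSpace (sdpFull A (charStab H ψ))
      (extTensor (charBar ψ) (charStab H ψ) (charStab_charBar ψ).ge σ)) :=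
  induced (sdpFull A (charStab H ψ))
    (extTensor (charBar ψ) (charStab H ψ) (charStab_charBar ψ).ge σ)

end Semidirect

/-! ### The homogeneous space -/

/-- A compatible system over the `H`-set `Y`: isomorphisms `h : B y → B (h y)` and surjective
homomorphisms `π y : A → B y` with `(h h') b = h (h' b)`, `1 b = b` and `h ∘ π_y = π_{h y} ∘ h`.
The first two identities hold between elements of the disjoint union of the `B y`. -/
structure FiberSystem (H A Y : Type*) [Group H] [AddCommGroup A] [DistribMulAction H A]
    [MulAction H Y] (B : Y → Type*) [∀ y, AddCommGroup (B y)] where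
  act : ∀ (h : H) (y : Y), B y ≃+ B (h • y)
  act_one : ∀ (y : Y) (b : B y), (⟨(1 : H) • y, act 1 y b⟩ : Σ y, B y) = ⟨y, b⟩
  act_mul : ∀ (h h' : H) (y : Y) (b : B y),
    (⟨(h * h') • y, act (h * h') y b⟩ : Σ y, B y) = ⟨h • h' • y, act h (h' • y) (act h' y b)⟩
  proj : ∀ y, A →+ B y
  proj_surjective : ∀ y, Function.Surjective (proj y)
  act_proj : ∀ (h : H) (y : Y) (a : A), act h y (proj y a) = proj (h • y) (h • a)

namespace FiberSystem

variable {H A Y : Type*} [Group H] [AddCommGroup A] [DistribMulAction H A] [MulAction H Y]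
  {B : Y → Type*} [∀ y, AddCommGroup (B y)]

/-- The space `X = {(y, b) : y ∈ Y, b ∈ B y}`. -/
@[nolint unusedArguments]
def Total (_S : FiberSystem H A Y B) : Type _ := Σ y, B y

/-- The action `(h, a) (y, b) = (h y, π_{h y}(a) + h b)` of `H ⋉ A` on `X`. -/
instance totalAction (S : FiberSystem H A Y B) : MulAction (SDP H A) S.Total where
  smul g x := ⟨g.right • x.1, S.proj (g.right • x.1) g.vec + S.act g.right x.1 x.2⟩
  one_smul x := by
    obtain ⟨y, b⟩ := x
    change (⟨(1 : H) • y, S.proj ((1 : H) • y) 0 + S.act 1 y b⟩ : Σ y, B y) = ⟨y, b⟩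
    rw [map_zero, zero_add, S.act_one]
  mul_smul g g' x := by
    obtain ⟨y, b⟩ := x
    change (⟨(g.right * g'.right) • y, S.proj ((g.right * g'.right) • y)
        (g.vec + g.right • g'.vec) + S.act (g.right * g'.right) y b⟩ : Σ y, B y)
      = ⟨g.right • g'.right • y, S.proj (g.right • g'.right • y) g.vec
        + S.act g.right (g'.right • y) (S.proj (g'.right • y) g'.vec + S.act g'.right y b)⟩
    have key : ∀ (z z' : Y) (u : B z) (u' : B z') (v : A),
        (⟨z, u⟩ : Σ y, B y) = ⟨z', u'⟩ →
        (⟨z, S.proj z v + u⟩ : Σ y, B y) = ⟨z', S.proj z' v + u'⟩ := by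
      intro z z' u u' v huv
      obtain ⟨rfl, huv⟩ := Sigma.mk.inj huv
      rw [eq_of_heq huv]
    rw [key _ _ _ _ _ (S.act_mul g.right g'.right y b), map_add, map_add, S.act_proj, add_assoc]

/-- The kernel `C` of `π = π_{y₀}`. -/
def ker (S : FiberSystem H A Y B) (y₀ : Y) : AddSubgroup A := (S.proj y₀).ker

theorem ker_invariant (S : FiberSystem H A Y B) (y₀ : Y) :
    ∀ k ∈ MulAction.stabilizer H y₀, ∀ c ∈ S.ker y₀, k • c ∈ S.ker y₀ := by
  intro k hk c hc
  have h1 : S.proj (k • y₀) (k • c) = 0 := by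
    rw [← S.act_proj, show S.proj y₀ c = 0 from hc, map_zero]
  have h2 : k • y₀ = y₀ := hk
  change S.proj y₀ (k • c) = 0
  rw [h2] at h1
  exact h1

/-- The subgroup `K ⋉ C` of `H ⋉ A`, where `K` is the stabilizer of `y₀` and `C = ker π_{y₀}`. -/
def KC (S : FiberSystem H A Y B) (y₀ : Y) : Subgroup (SDP H A) :=
  sdpSubgroup (MulAction.stabilizer H y₀) (S.ker y₀) (S.ker_invariant y₀)

/-- The action of `k ∈ K` on `B = B_{y₀}`: the isomorphism `B_{y₀} → B_{k y₀}` followed by the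
identification of `B_{k y₀}` with `B_{y₀}`. -/
def stabAct (S : FiberSystem H A Y B) (y₀ : Y) (k : MulAction.stabilizer H y₀) : B y₀ ≃+ B y₀ :=
  (S.act k y₀).trans (AddEquiv.cast (M := B) k.2)

/-- The inflation `θ^△ = θ ∘ π` to `A` of a character `θ` of `B = B_{y₀}`. -/
def infl (S : FiberSystem H A Y B) {y₀ : Y} (θ : AddChar (B y₀) Circle) : AddChar A Circle :=
  θ.compAddMonoidHom (S.proj y₀)

/-- The conjugate `ᵏθ` of a character `θ` of `B` by `k ∈ K`: `ᵏθ(b) = θ(k⁻¹ b)`. -/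
def dualConj (S : FiberSystem H A Y B) {y₀ : Y} (k : MulAction.stabilizer H y₀)
    (θ : AddChar (B y₀) Circle) : AddChar (B y₀) Circle :=
  θ.compAddMonoidHom (S.stabAct y₀ k⁻¹).toAddMonoidHom

/-- The stabilizer `H_θ` in `H` of the inflation of `θ`. -/
abbrev Hstab (S : FiberSystem H A Y B) {y₀ : Y} (θ : AddChar (B y₀) Circle) : Subgroup H :=
  charStab H (S.infl θ)

/-- The subgroup `K_θ = H_θ ∩ K`, as a subgroup of `H_θ`. -/
def Kstab (S : FiberSystem H A Y B) {y₀ : Y} (θ : AddChar (B y₀) Circle) :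
    Subgroup (S.Hstab θ) :=
  (MulAction.stabilizer H y₀).subgroupOf (S.Hstab θ)

/-- `Θ` is a complete set of representatives for the `K`-orbits on the dual of `B`. -/
def IsKOrbitReps (S : FiberSystem H A Y B) {y₀ : Y} (Θ : Finset (AddChar (B y₀) Circle)) : Prop :=
  ∀ χ : AddChar (B y₀) Circle, ∃! θ, θ ∈ Θ ∧ ∃ k, S.dualConj k θ = χ

/-- The inflations of the elements of `Ξ ⊆ Θ` form a complete set of representatives for those
`H`-orbits on the dual of `A` that contain a character inflated from `B`. -/
def IsHOrbitReps (S : FiberSystem H A Y B) {y₀ : Y} (Θ Ξ : Finset (AddChar (B y₀) Circle)) :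
    Prop :=
  Ξ ⊆ Θ ∧ ∀ ψ : AddChar A Circle, (∃ (h : H) (χ : AddChar (B y₀) Circle),
    charConj h (S.infl χ) = ψ) → ∃! ξ, ξ ∈ Ξ ∧ ∃ h : H, charConj h (S.infl ξ) = ψ

open scoped Classical in
/-- The set `[ξ]` of the `θ ∈ Θ` whose inflated `K`-orbit is contained in the `H`-orbit of the
inflation of `ξ`. -/
def orbitClass (S : FiberSystem H A Y B) {y₀ : Y} (Θ : Finset (AddChar (B y₀) Circle))
    (ξ : AddChar (B y₀) Circle) : Finset (AddChar (B y₀) Circle) :=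
  Θ.filter fun θ => {ψ | ∃ k ∈ MulAction.stabilizer H y₀, charConj k (S.infl θ) = ψ} ⊆
    {ψ | ∃ h : H, charConj h (S.infl ξ) = ψ}

/-- For irreducible `σ` of `H_ξ` and a representation `τ` of `H_θ`: there is `h ∈ H` with
`ʰ(ξ^△) = θ^△` and `ʰσ ∼ τ`. -/
def ConjugatePair (S : FiberSystem H A Y B) {y₀ : Y} (ξ θ : AddChar (B y₀) Circle)
    {V W : Type*} [AddCommGroup V] [Module ℂ V] [AddCommGroup W] [Module ℂ W]
    (σ : Representation ℂ (S.Hstab ξ) V) (τ : Representation ℂ (S.Hstab θ) W) : Prop :=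
  ∃ (h : H) (e : charConj h (S.infl ξ) = S.infl θ),
    Equivalent (conjRep h (charStab_conj e) σ) τ

end FiberSystem

end SemidirectPerm

end

/-!
The representation of `H ⋉ A` on `L(X)` is analysed by restricting it to `A`.

Since `X` is a transitive `H ⋉ A`-set and `K ⋉ C` is the stabilizer of `(y₀, 0)`, the functions on
`X` are the functions `F` on `H ⋉ A` that are right invariant under `K ⋉ C`
(`permRep_equivalent_induced`, `FiberSystem.stabilizer_base`). For a character `ψ` of `A` consider
the Fourier coefficients `F_ψ(g) = ∑ₐ F(g a) ψ̄(a)`. They vanish unless `ψ` is trivial on `C`, that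
is, inflated from `B`; they satisfy `F_ψ(g a) = ψ(a) F_ψ(g)`, and `F_ψ(g k) = F_{ᵏψ}(g)` for
`k ∈ K`. Hence `g ↦ (s K_ψ ↦ F_ψ(g s))` is an element of the representation attached to `ψ` and
`L(H_ψ / K_ψ)` (`fourierMap`), and by Fourier inversion `F` is determined by its coefficients at one
representative `ψ = θ^△` of every `K`-orbit. Splitting `L(H_θ / K_θ)` into the `σ_{θ,j}` gives an
injective intertwining map from `L(X)` to the asserted direct sum. The dimensions agree, because
`[H : H_θ] [H_θ : K_θ] = [H : K] [K : K_θ]` and because the `K`-orbits, of lengths `[K : K_θ]`,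
partition the dual of `B`; so the map is an equivalence (`induced_equivalent_directSum`).

The rest is the little group method of Wigner and Mackey. In `littleGroupRep ψ σ`, the operator
`∑ₐ φ(a) a` multiplies a function by `|A|` on the cosets of those `h` with `ʰψ = φ`, and by `0` on
all other cosets. With `φ = ψ` it singles out a copy of `σ` that generates the whole space, whence
irreducibility (`littleGroupRep_isIrreducible`); with general `φ` it shows that
`littleGroupRep ψ σ` and `littleGroupRep φ τ` are equivalent exactly when some `h` carries `(ψ, σ)`
to `(φ, τ)` (`littleGroupRep_equivalent_iff`). Schur's lemma then turns multiplicities into the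
number of conjugate summands. The trivial representation of `H_θ` occurs once in `L(H_θ / K_θ)`,
so for the trivial representation of `H_ξ` every `θ ∈ [ξ]` contributes exactly one.
-/

noncomputable section

namespace SemidirectPerm

/-! ### Intertwining maps, multiplicities and permutation representations -/

section General

variable {G : Type*} [Group G]

theorem Equivalent.symm {V W : Type*} [AddCommMonoid V] [Module ℂ V] [AddCommMonoid W]
    [Module ℂ W] {ρ : Representation ℂ G V} {τ : Representation ℂ G W}
    (h : Equivalent ρ τ) : Equivalent τ ρ :=
  h.map fun e => e.symm

theorem Equivalent.trans {V W Z : Type*} [AddCommMonoid V] [Module ℂ V] [AddCommMonoid W]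
    [Module ℂ W] [AddCommMonoid Z] [Module ℂ Z] {ρ : Representation ℂ G V}
    {τ : Representation ℂ G W} {υ : Representation ℂ G Z}
    (h : Equivalent ρ τ) (h' : Equivalent τ υ) : Equivalent ρ υ :=
  ⟨h.some.trans h'.some⟩

variable {V W : Type*} [AddCommGroup V] [Module ℂ V] [AddCommGroup W] [Module ℂ W]

theorem isIrreducible_of_forall {ρ : Representation ℂ G V} [Nontrivial V]
    (h : ∀ (M : Submodule ℂ V), (∀ g, ∀ v ∈ M, ρ g v ∈ M) → ∀ v ∈ M, v ≠ 0 → M = ⊤) :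
    ρ.IsIrreducible where
  exists_pair_ne := by
    refine ⟨⊥, ⊤, fun hbt => ?_⟩
    obtain ⟨v, hv⟩ := exists_ne (0 : V)
    have : v ∈ (⊥ : Subrepresentation ρ) := hbt ▸ (Submodule.mem_top : v ∈ (⊤ : Submodule ℂ V))
    exact hv ((Submodule.mem_bot ℂ).1 this)
  eq_bot_or_eq_top M := by
    by_cases hM : ∃ v ∈ M.toSubmodule, v ≠ 0
    · obtain ⟨v, hv, hv0⟩ := hM
      exact Or.inr (Subrepresentation.toSubmodule_injective
        (h M.toSubmodule (fun g v hv => M.apply_mem_toSubmodule g hv) v hv hv0))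
    · push Not at hM
      exact Or.inl (Subrepresentation.toSubmodule_injective ((Submodule.eq_bot_iff _).2 hM))

theorem nontrivial_of_isIrreducible {ρ : Representation ℂ G V} (hρ : ρ.IsIrreducible) :
    Nontrivial V := by
  by_contra hV
  rw [not_nontrivial_iff_subsingleton] at hV
  obtain ⟨M, N, hMN⟩ := hρ.exists_pair_ne
  exact hMN (Subrepresentation.toSubmodule_injective (Subsingleton.elim _ _))

theorem eq_top_of_isIrreducible {ρ : Representation ℂ G V} (hρ : ρ.IsIrreducible)
    (M : Submodule ℂ V) (hM : ∀ g, ∀ v ∈ M, ρ g v ∈ M) {v : V} (hv : v ∈ M) (hv0 : v ≠ 0) :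
    M = ⊤ := by
  rcases hρ.eq_bot_or_eq_top ⟨M, fun g v hv => hM g v hv⟩ with h | h
  · have : v ∈ (⊥ : Subrepresentation ρ) :=
      h ▸ (hv : v ∈ (⟨M, fun g v hv => hM g v hv⟩ : Subrepresentation ρ))
    exact absurd ((Submodule.mem_bot ℂ).1 this) hv0
  · exact congrArg Subrepresentation.toSubmodule h

/-- The finitely many translates of a nonzero vector span. -/
theorem finiteDimensional_of_isIrreducible [Finite G] {ρ : Representation ℂ G V}
    (hρ : ρ.IsIrreducible) : FiniteDimensional ℂ V := by
  have := nontrivial_of_isIrreducible hρ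
  obtain ⟨v, hv⟩ := exists_ne (0 : V)
  have hspan : Submodule.span ℂ (Set.range fun g => ρ g v) = ⊤ := by
    refine eq_top_of_isIrreducible hρ _ (fun g w hw => ?_)
      (Submodule.subset_span ⟨1, by simp⟩) hv
    have hle : Submodule.span ℂ (Set.range fun g => ρ g v) ≤
        (Submodule.span ℂ (Set.range fun g => ρ g v)).comap (ρ g) := by
      rw [Submodule.span_le]
      rintro _ ⟨g', rfl⟩
      exact Submodule.subset_span ⟨g * g', by simp⟩
    exact hle hw
  exact Module.finite_def.2 (hspan ▸ Submodule.fg_span (Set.finite_range _))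

/-- Schur's lemma for a linear map that commutes with the actions. -/
theorem equivalent_of_ne_zero {ρ : Representation ℂ G V} {τ : Representation ℂ G W}
    (hρ : ρ.IsIrreducible) (hτ : τ.IsIrreducible) (T : V →ₗ[ℂ] W)
    (hT : ∀ g v, T (ρ g v) = τ g (T v)) {v : V} (hv : T v ≠ 0) : Equivalent ρ τ := by
  let T' : ρ.IntertwiningMap τ := LinearMap.intertwiningMap_of_isIntertwiningMap ρ τ T hT
  rcases Representation.IsIrreducible.bijective_or_eq_zero T' with h | h
  · exact ⟨T'.ofBijective h⟩
  · exact absurd (congrArg (fun f : ρ.IntertwiningMap τ => f v) h) hv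

theorem Equivalent.exists_linearEquiv {V W : Type*} [AddCommMonoid V] [Module ℂ V]
    [AddCommMonoid W] [Module ℂ W] {ρ : Representation ℂ G V} {τ : Representation ℂ G W}
    (h : Equivalent ρ τ) : ∃ e : V ≃ₗ[ℂ] W, ∀ g v, e (ρ g v) = τ g (e v) :=
  h.elim fun e => ⟨e.toLinearEquiv, fun g v => e.toIntertwiningMap.isIntertwining _ _ g v⟩

theorem Equivalent.of_linearEquiv {V W : Type*} [AddCommMonoid V] [Module ℂ V]
    [AddCommMonoid W] [Module ℂ W] {ρ : Representation ℂ G V} {τ : Representation ℂ G W}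
    (e : V ≃ₗ[ℂ] W) (he : ∀ g v, e (ρ g v) = τ g (e v)) : Equivalent ρ τ :=
  ⟨Representation.Equiv.mk e fun g => LinearMap.ext (he g)⟩

theorem multiplicity_congr_right {Z : Type*} [AddCommGroup Z] [Module ℂ Z]
    (υ : Representation ℂ G Z) {ρ : Representation ℂ G V} {τ : Representation ℂ G W}
    (h : Equivalent ρ τ) : multiplicity υ ρ = multiplicity υ τ := by
  obtain ⟨e⟩ := h
  exact LinearEquiv.finrank_eq
    { toFun f := e.toIntertwiningMap.comp f
      invFun f := e.symm.toIntertwiningMap.comp f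
      map_add' f g := by ext v; simp
      map_smul' c f := by ext v; simp
      left_inv f := by ext v; simp
      right_inv f := by ext v; simp }

theorem multiplicity_eq_one_of_equivalent [Finite G] {ρ : Representation ℂ G V}
    {τ : Representation ℂ G W} (hρ : ρ.IsIrreducible) (h : Equivalent ρ τ) :
    multiplicity ρ τ = 1 := by
  have := finiteDimensional_of_isIrreducible hρ
  rw [← multiplicity_congr_right ρ h]
  exact Representation.IsIrreducible.finrank_intertwiningMap_self ρ

theorem multiplicity_eq_zero_of_not_equivalent {ρ : Representation ℂ G V}
    {τ : Representation ℂ G W} (hρ : ρ.IsIrreducible) (hτ : τ.IsIrreducible)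
    (h : ¬ Equivalent ρ τ) : multiplicity ρ τ = 0 := by
  have : IsEmpty (ρ.Equiv τ) := not_nonempty_iff.1 h
  exact Module.finrank_zero_of_subsingleton

open scoped Classical in
/-- By Schur's lemma, an irreducible representation occurs in a sum of irreducible ones as often as
it is equivalent to a summand. -/
theorem multiplicity_of_equivalent_directSum [Finite G] {ρ : Representation ℂ G V}
    (hρ : ρ.IsIrreducible) {π : Representation ℂ G W}
    {ι : Type*} [Fintype ι] {U : ι → Type*} [∀ i, AddCommGroup (U i)] [∀ i, Module ℂ (U i)]
    {τ : ∀ i, Representation ℂ G (U i)} (hπ : Equivalent π (Representation.directSum τ))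
    (hτ : ∀ i, (τ i).IsIrreducible) :
    multiplicity ρ π = ∑ i, if Equivalent ρ (τ i) then 1 else 0 := by
  have := finiteDimensional_of_isIrreducible hρ
  have := fun i => finiteDimensional_of_isIrreducible (hτ i)
  let D := DirectSum.linearEquivFunOnFintype ℂ ι U
  let E : ρ.IntertwiningMap (Representation.directSum τ) ≃ₗ[ℂ] ∀ i, ρ.IntertwiningMap (τ i) :=
    { toFun f i := LinearMap.intertwiningMap_of_isIntertwiningMap ρ (τ i)
        (DirectSum.component ℂ ι U i ∘ₗ f.toLinearMap) fun g v => by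
          change f (ρ g v) i = τ i g (f v i)
          rw [f.isIntertwining]
          exact DirectSum.lmap_apply ..
      invFun f := LinearMap.intertwiningMap_of_isIntertwiningMap ρ _
        (D.symm.toLinearMap ∘ₗ
          LinearMap.pi fun i => (f i).toLinearMap) fun g v => by
          refine DFinsupp.ext fun i => ?_
          exact (congrFun (D.apply_symm_apply fun i => f i (ρ g v)) i).trans <|
            ((f i).isIntertwining _ _ g v).trans <|
            congrArg (τ i g) (congrFun (D.apply_symm_apply fun i => f i v) i).symm
      map_add' f g := by ext i v; rfl
      map_smul' c f := by ext i v; rfl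
      left_inv f := by
        ext v : 2
        exact D.symm_apply_apply (f v)
      right_inv f := by
        ext i v
        exact congrFun (D.apply_symm_apply fun i => f i v) i }
  rw [multiplicity_congr_right (W := DirectSum ι U) ρ hπ, multiplicity, E.finrank_eq,
    Module.finrank_pi_fintype]
  refine Finset.sum_congr rfl fun i _ => ?_
  split_ifs with h
  · exact multiplicity_eq_one_of_equivalent hρ h
  · exact multiplicity_eq_zero_of_not_equivalent hρ (hτ i) h

variable {X : Type*} [MulAction G X] [MulAction.IsPretransitive G X]

/-- The functions on a transitive `G`-set `X` are the functions on `G` that are invariant under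
right multiplication by the stabilizer of a point `x₀`, via `f ↦ (g ↦ f (g x₀))`. -/
theorem permRep_equivalent_induced (x₀ : X) {S : Subgroup G}
    (hS : MulAction.stabilizer G x₀ = S) :
    Equivalent (permRep G X) (induced S (Representation.trivial ℂ S ℂ)) := by
  let T : (X → ℂ) →ₗ[ℂ] inducedSpace S (Representation.trivial ℂ S ℂ) :=
    { toFun f := ⟨fun g => f (g • x₀), fun g s => by
        have : (s : G) • x₀ = x₀ := by
          rw [← MulAction.mem_stabilizer_iff, hS]
          exact s.2
        simp [mul_smul, this]⟩
      map_add' f g := rfl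
      map_smul' c f := rfl }
  refine .of_linearEquiv (LinearEquiv.ofBijective T ⟨?_, ?_⟩) ?_
  · intro f f' h
    funext x
    obtain ⟨g, rfl⟩ := MulAction.exists_smul_eq G x₀ x
    exact congrFun (congrArg Subtype.val h) g
  · intro F
    refine ⟨fun x => F.1 (MulAction.exists_smul_eq G x₀ x).choose, Subtype.ext (funext fun g => ?_)⟩
    have hg := (MulAction.exists_smul_eq G x₀ (g • x₀)).choose_spec
    set g' := (MulAction.exists_smul_eq G x₀ (g • x₀)).choose
    have hs : g⁻¹ * g' ∈ S := by
      rw [← hS, MulAction.mem_stabilizer_iff, mul_smul, hg, inv_smul_smul]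
    have := F.2 g ⟨_, hs⟩
    simpa [T] using this
  · intro g f
    apply Subtype.ext
    funext x
    exact congrArg f (mul_smul g⁻¹ x x₀).symm

theorem isIrreducible_trivial : (Representation.trivial ℂ G ℂ).IsIrreducible :=
  isIrreducible_of_forall fun M _ v hv hv0 => by
    rw [eq_top_iff]
    intro w _
    simpa [hv0] using M.smul_mem (w / v) hv

/-- The invariant functions on a transitive `G`-set are the constants. -/
theorem multiplicity_trivial_permRep [Nonempty X] :
    multiplicity (Representation.trivial ℂ G ℂ) (permRep G X) = 1 := by
  obtain ⟨x₀⟩ := ‹Nonempty X›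
  let T : (Representation.trivial ℂ G ℂ).IntertwiningMap (permRep G X) →ₗ[ℂ] ℂ :=
    { toFun f := f 1 x₀
      map_add' f g := rfl
      map_smul' c f := rfl }
  refine (LinearEquiv.ofBijective T ⟨?_, ?_⟩).finrank_eq.trans (Module.finrank_self ℂ)
  · rw [← LinearMap.ker_eq_bot, LinearMap.ker_eq_bot']
    intro f hf
    ext x
    obtain ⟨g, rfl⟩ := MulAction.exists_smul_eq G x₀ x
    have h : f 1 x₀ = f 1 (g⁻¹⁻¹ • x₀) := congrFun (f.isIntertwining _ _ g⁻¹ 1) x₀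
    rw [inv_inv] at h
    exact h.symm.trans hf
  · intro c
    exact ⟨LinearMap.intertwiningMap_of_isIntertwiningMap _ _
      (LinearMap.pi fun _ => c • LinearMap.id) fun g v => by
        funext x
        simp [permRep, LinearMap.funLeft_apply], by simp [T]⟩

end General

/-! ### Induced representations -/

section Induced

variable {G : Type*} [Group G] {S : Subgroup G} {V : Type*} [AddCommGroup V] [Module ℂ V]
  {σ : Representation ℂ S V}

theorem induced_apply (g x : G) (F : inducedSpace S σ) :
    (induced S σ g F).1 x = F.1 (g⁻¹ * x) := rfl

open scoped Classical in
/-- The element of the induced representation that is supported on `S` and takes the value `v`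
at `1`. -/
def inducedSingle (σ : Representation ℂ S V) : V →ₗ[ℂ] inducedSpace S σ where
  toFun v := ⟨fun g => if h : g ∈ S then σ ⟨g, h⟩⁻¹ v else 0, fun g s => by
    by_cases h : g ∈ S
    · have h' : g * s ∈ S := S.mul_mem h s.2
      have : (⟨g * s, h'⟩ : S)⁻¹ = s⁻¹ * ⟨g, h⟩⁻¹ := by
        rw [← mul_inv_rev]
        rfl
      simp only [h, h', dif_pos, this, map_mul, Module.End.mul_apply]
    · have h' : ¬ g * s ∈ S := fun h' => h ((S.mul_mem_cancel_right s.2).1 h')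
      simp only [h, h', dif_neg, not_false_iff, map_zero]⟩
  map_add' v w := by
    apply Subtype.ext
    funext g
    by_cases h : g ∈ S <;> simp [h]
  map_smul' c v := by
    apply Subtype.ext
    funext g
    by_cases h : g ∈ S <;> simp [h]

theorem inducedSingle_apply_of_mem (v : V) {g : G} (h : g ∈ S) :
    (inducedSingle σ v).1 g = σ ⟨g, h⟩⁻¹ v := dif_pos h

theorem inducedSingle_apply_of_notMem (v : V) {g : G} (h : g ∉ S) :
    (inducedSingle σ v).1 g = 0 := dif_neg h

theorem inducedSingle_apply_one (v : V) : (inducedSingle σ v).1 1 = v := by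
  have : (⟨1, S.one_mem⟩ : S)⁻¹ = 1 := inv_one
  rw [inducedSingle_apply_of_mem v S.one_mem, this, map_one, Module.End.one_apply]

theorem apply_of_mem (F : inducedSpace S σ) {g : G} (h : g ∈ S) :
    F.1 g = σ ⟨g, h⟩⁻¹ (F.1 1) := by
  simpa using F.2 1 ⟨g, h⟩

theorem eq_inducedSingle (F : inducedSpace S σ) (hF : ∀ g, g ∉ S → F.1 g = 0) :
    F = inducedSingle σ (F.1 1) := by
  apply Subtype.ext
  funext g
  by_cases h : g ∈ S
  · rw [inducedSingle_apply_of_mem _ h, apply_of_mem F h]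
  · rw [inducedSingle_apply_of_notMem _ h, hF g h]

theorem inducedSingle_rep (s : S) (v : V) :
    inducedSingle σ (σ s v) = induced S σ s (inducedSingle σ v) := by
  refine ((eq_inducedSingle _ fun g hg => ?_).trans ?_).symm
  · rw [induced_apply]
    exact inducedSingle_apply_of_notMem _ fun h => hg ((S.mul_mem_cancel_left (S.inv_mem s.2)).1 h)
  · rw [induced_apply, inducedSingle_apply_of_mem _ (by simp)]
    congr 3
    ext
    simp

open scoped Classical in
/-- Every `F` is the average of the translates `g · δ_{F(g)}`, where `δ_v` is supported on `S` with
value `v` at `1`; so the functions supported on `S` generate the induced representation. -/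
theorem sum_induced_inducedSingle [Fintype G] (F : inducedSpace S σ) :
    ∑ g, induced S σ g (inducedSingle σ (F.1 g)) = (Fintype.card S : ℂ) • F := by
  apply Subtype.ext
  funext x
  have key : ∀ g, (induced S σ g (inducedSingle σ (F.1 g))).1 x
      = if g⁻¹ * x ∈ S then F.1 x else 0 := by
    intro g
    rw [induced_apply]
    split_ifs with h
    · rw [inducedSingle_apply_of_mem _ h, ← F.2 g ⟨_, h⟩, mul_inv_cancel_left]
    · rw [inducedSingle_apply_of_notMem _ h]
  have hsum : (∑ g, induced S σ g (inducedSingle σ (F.1 g))).1 x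
      = ∑ g, if g⁻¹ * x ∈ S then F.1 x else 0 := by
    rw [Submodule.coe_sum, Finset.sum_apply]
    exact Finset.sum_congr rfl fun g _ => key g
  -- substitute `g = x t⁻¹`, so that the condition reads `t ∈ S`
  rw [hsum, ← Equiv.sum_comp ((Equiv.inv G).trans (Equiv.mulLeft x))]
  simp [Finset.sum_ite, Fintype.card_subtype, ← Nat.cast_smul_eq_nsmul ℂ]

theorem eq_top_of_inducedSingle_mem [Finite G] (M : Submodule ℂ (inducedSpace S σ))
    (hM : ∀ g, ∀ F ∈ M, induced S σ g F ∈ M) (h : ∀ v, inducedSingle σ v ∈ M) : M = ⊤ := by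
  classical
  cases nonempty_fintype G
  rw [eq_top_iff]
  intro F _
  have hmem := M.sum_mem fun g (_ : g ∈ Finset.univ) => hM g _ (h (F.1 g))
  rw [sum_induced_inducedSingle] at hmem
  exact (M.smul_mem_iff (Nat.cast_ne_zero.2 Fintype.card_ne_zero)).1 hmem

/-- Evaluation at representatives of the left cosets of `S` identifies the induced space with the
functions `G ⧸ S → V`. -/
theorem finrank_inducedSpace [Finite G] [FiniteDimensional ℂ V] :
    Module.finrank ℂ (inducedSpace S σ) = S.index * Module.finrank ℂ V := by
  classical
  cases nonempty_fintype G
  have hout : ∀ g : G, ((g : G ⧸ S).out)⁻¹ * g ∈ S := fun g =>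
    QuotientGroup.eq.1 (QuotientGroup.out_eq' _)
  let T : inducedSpace S σ →ₗ[ℂ] (G ⧸ S → V) :=
    { toFun F q := F.1 q.out
      map_add' _ _ := rfl
      map_smul' _ _ := rfl }
  have hT : Function.Bijective T := by
    constructor
    · rw [← LinearMap.ker_eq_bot, LinearMap.ker_eq_bot']
      intro F hF
      apply Subtype.ext
      funext g
      have h1 := F.2 (g : G ⧸ S).out ⟨_, hout g⟩
      have h2 : F.1 (g : G ⧸ S).out = 0 := congrFun hF g
      rw [mul_inv_cancel_left, h2, map_zero] at h1
      exact h1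
    · intro f
      refine ⟨⟨fun g => σ ⟨_, hout g⟩⁻¹ (f g), fun g s => ?_⟩, ?_⟩
      · have hq : ((g * s : G) : G ⧸ S) = g := QuotientGroup.mk_mul_of_mem g s.2
        have hs : (⟨_, hout (g * s)⟩ : S)⁻¹ = s⁻¹ * ⟨_, hout g⟩⁻¹ := by
          rw [← mul_inv_rev]
          ext
          simp [mul_assoc]
        rw [← Module.End.mul_apply, ← map_mul]
        change σ (⟨_, hout (g * s)⟩ : S)⁻¹ (f ((g * s : G) : G ⧸ S)) = _
        rw [hs, hq]
      · funext q
        have : (⟨_, hout q.out⟩ : S)⁻¹ = 1 := by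
          ext
          simp
        change σ (⟨_, hout q.out⟩ : S)⁻¹ _ = _
        rw [this, map_one, QuotientGroup.out_eq', Module.End.one_apply]
  rw [(LinearEquiv.ofBijective T hT).finrank_eq, Module.finrank_pi_fintype, Finset.sum_const,
    Subgroup.index, Nat.card_eq_fintype_card, Finset.card_univ, smul_eq_mul]

end Induced

/-! ### The little group representations -/

section LittleGroup

variable {H A : Type*} [Group H] [AddCommGroup A] [DistribMulAction H A]

/-- The element `(1, a)` of `H ⋉ A`. -/
def SDP.inl (H : Type*) {A : Type*} [Group H] [AddCommGroup A] [DistribMulAction H A] (a : A) :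
    SDP H A :=
  SemidirectProduct.inl (Multiplicative.ofAdd a)

/-- The element `(h, 0)` of `H ⋉ A`. -/
def SDP.inr (A : Type*) {H : Type*} [Group H] [AddCommGroup A] [DistribMulAction H A] (h : H) :
    SDP H A :=
  SemidirectProduct.inr h

@[simp] theorem SDP.vec_inl (a : A) : (SDP.inl H a).vec = a := rfl
@[simp] theorem SDP.right_inl (a : A) : (SDP.inl H a).right = 1 := rfl
@[simp] theorem SDP.vec_inr (h : H) : (SDP.inr A h).vec = 0 := rfl
@[simp] theorem SDP.right_inr (h : H) : (SDP.inr A h).right = h := rfl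

theorem SDP.ext' {g g' : SDP H A} (h₁ : g.right = g'.right) (h₂ : g.vec = g'.vec) : g = g' :=
  SemidirectProduct.ext h₂ h₁

theorem SDP.inl_mul_inr (g : SDP H A) : SDP.inl H g.vec * SDP.inr A g.right = g :=
  SDP.ext' (by simp) (by simp)

theorem SDP.inr_mul_inl (g : SDP H A) :
    SDP.inr A g.right * SDP.inl H (g.right⁻¹ • g.vec) = g :=
  SDP.ext' (by simp) (by simp)

theorem SDP.inl_add (a b : A) : SDP.inl H (a + b) = SDP.inl H a * SDP.inl H b :=
  SDP.ext' (by simp) (by simp)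

theorem SDP.inl_neg (a : A) : SDP.inl H (-a) = (SDP.inl H a)⁻¹ :=
  SDP.ext' (by simp) (by simp)

theorem SDP.inr_inv (h : H) : SDP.inr A h⁻¹ = (SDP.inr A h)⁻¹ :=
  SDP.ext' (by simp) (by simp)

theorem SDP.inr_mul (h h' : H) : SDP.inr A (h * h') = SDP.inr A h * SDP.inr A h' :=
  SDP.ext' (by simp) (by simp)

theorem SDP.inl_mul (a : A) (g : SDP H A) : SDP.inl H a * g = g * SDP.inl H (g.right⁻¹ • a) :=
  SDP.ext' (by simp) (by simp [add_comm])

variable {ψ φ : AddChar A Circle} {V W : Type*} [AddCommGroup V] [Module ℂ V] [AddCommGroup W]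
  [Module ℂ W] {σ : Representation ℂ (charStab H ψ) V} {τ : Representation ℂ (charStab H φ) W}

/-- The space of the representation `littleGroupRep ψ σ`. -/
abbrev LittleGroupSpace (ψ : AddChar A Circle) (σ : Representation ℂ (charStab H ψ) V) :
    Submodule ℂ (SDP H A → V) :=
  inducedSpace (sdpFull A (charStab H ψ))
    (extTensor (charBar ψ) (charStab H ψ) (charStab_charBar ψ).ge σ)

theorem mem_sdpFull {J : Subgroup H} {g : SDP H A} : g ∈ sdpFull A J ↔ g.right ∈ J :=
  and_iff_left (AddSubgroup.mem_top _)

theorem conj_mem_charStab {h : H} (e : charConj h ψ = φ) (t : charStab H φ) :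
    h⁻¹ * t * h ∈ charStab H ψ := by
  subst e
  have ht : charConj (t : H) (charConj h ψ) = charConj h ψ := t.2
  rw [mem_charStab, charConj_mul, charConj_mul, ht, ← charConj_mul, inv_mul_cancel, charConj_one]

theorem extTensor_inv_apply {χ : AddChar A Circle} {J : Subgroup H} {hJ : J ≤ charStab H χ}
    {σ : Representation ℂ J V} {g : SDP H A} (hg : g ∈ sdpFull A J) (v : V) :
    extTensor χ J hJ σ ⟨g, hg⟩⁻¹ v =
      (χ (-(g.right⁻¹ • g.vec)) : ℂ) • σ ⟨g.right, mem_sdpFull.1 hg⟩⁻¹ v := by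
  rw [← SDP.vec_inv]
  rfl

theorem LittleGroupSpace.apply_mul_inl (F : LittleGroupSpace ψ σ) (g : SDP H A) (a : A) :
    F.1 (g * SDP.inl H a) = (ψ a : ℂ) • F.1 g := by
  refine (F.2 g ⟨SDP.inl H a, mem_sdpFull.2 (one_mem _)⟩).trans ?_
  rw [extTensor_inv_apply]
  have h1 : (⟨(SDP.inl H a).right, one_mem _⟩ : charStab H ψ)⁻¹ = 1 := inv_one
  rw [h1, map_one]
  simp [charBar]

theorem LittleGroupSpace.apply_mul_inr (F : LittleGroupSpace ψ σ) (g : SDP H A)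
    (s : charStab H ψ) : F.1 (g * SDP.inr A (s : H)) = σ s⁻¹ (F.1 g) := by
  refine (F.2 g ⟨SDP.inr A s, mem_sdpFull.2 s.2⟩).trans ?_
  rw [extTensor_inv_apply]
  simp

/-- Covariance under `A` and under the stabilizer may be checked separately. -/
theorem mem_littleGroupSpace {f : SDP H A → V} (h₁ : ∀ g a, f (g * SDP.inl H a) = (ψ a : ℂ) • f g)
    (h₂ : ∀ g (s : charStab H ψ), f (g * SDP.inr A (s : H)) = σ s⁻¹ (f g)) :
    f ∈ LittleGroupSpace ψ σ := by
  rintro g ⟨s, hs⟩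
  rw [extTensor_inv_apply hs, ← h₂]
  change f (g * s) = _
  conv_lhs => rw [← SDP.inr_mul_inl s, ← mul_assoc, h₁]
  simp [charBar]

theorem littleGroupRep_apply (g x : SDP H A) (F : LittleGroupSpace ψ σ) :
    (littleGroupRep ψ σ g F).1 x = F.1 (g⁻¹ * x) := rfl

/-- `A` acts on the functions supported on the coset of `g` by the conjugate of `ʰψ`, where `h` is
the component of `g` in `H`. -/
theorem littleGroupRep_inl_apply (a : A) (F : LittleGroupSpace ψ σ) (g : SDP H A) :
    (littleGroupRep ψ σ (SDP.inl H a) F).1 g = (ψ (-(g.right⁻¹ • a)) : ℂ) • F.1 g := by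
  rw [littleGroupRep_apply, ← SDP.inl_neg, SDP.inl_mul, LittleGroupSpace.apply_mul_inl, smul_neg]

theorem sum_char_eq_zero [Fintype A] {χ : AddChar A Circle} (hχ : χ ≠ 1) :
    ∑ a, (χ a : ℂ) = 0 := by
  have h : Circle.coeHom.compAddChar χ ≠ 0 := by
    intro h0
    refine hχ (DFunLike.ext _ _ fun a => Circle.ext ?_)
    exact DFunLike.congr_fun h0 a
  exact AddChar.sum_eq_zero_iff_ne_zero.2 h

/-- The sum `∑ₐ φ(a) ρ(a)`: up to the factor `|A|`, the projection of a representation of `H ⋉ A`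
onto the subspace on which `A` acts by the conjugate of `φ`. -/
def charSum [Fintype A] (ρ : Representation ℂ (SDP H A) V) (φ : AddChar A Circle) : V →ₗ[ℂ] V :=
  ∑ a, (φ a : ℂ) • ρ (SDP.inl H a)

theorem charSum_littleGroupRep [Fintype A] (F : LittleGroupSpace ψ σ) (g : SDP H A) :
    (charSum (littleGroupRep ψ σ) φ F).1 g =
      (∑ a, ((φ * (charConj g.right ψ)⁻¹) a : ℂ)) • F.1 g := by
  rw [Finset.sum_smul]
  simp only [charSum, LinearMap.sum_apply, Submodule.coe_sum, Finset.sum_apply]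
  refine Finset.sum_congr rfl fun a _ => ?_
  rw [LinearMap.smul_apply, Submodule.coe_smul, Pi.smul_apply, littleGroupRep_inl_apply, smul_smul]
  simp

theorem charSum_littleGroupRep_of_eq [Fintype A] (F : LittleGroupSpace ψ σ) {g : SDP H A}
    (h : charConj g.right ψ = φ) :
    (charSum (littleGroupRep ψ σ) φ F).1 g = (Fintype.card A : ℂ) • F.1 g := by
  rw [charSum_littleGroupRep, h, mul_inv_cancel]
  simp

theorem charSum_littleGroupRep_of_ne [Fintype A] (F : LittleGroupSpace ψ σ) {g : SDP H A}
    (h : charConj g.right ψ ≠ φ) : (charSum (littleGroupRep ψ σ) φ F).1 g = 0 := by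
  rw [charSum_littleGroupRep, sum_char_eq_zero fun h' => h (mul_inv_eq_one.1 h').symm, zero_smul]

/-- Intertwining maps commute with `charSum`. -/
theorem map_charSum [Fintype A] {ρ : Representation ℂ (SDP H A) V}
    {τ : Representation ℂ (SDP H A) W} (T : V →ₗ[ℂ] W) (hT : ∀ g v, T (ρ g v) = τ g (T v))
    (v : V) : T (charSum ρ φ v) = charSum τ φ (T v) := by
  simp [charSum, LinearMap.sum_apply, map_sum, hT]

theorem charSum_mem [Fintype A] {ρ : Representation ℂ (SDP H A) V} (M : Submodule ℂ V)
    (hM : ∀ g, ∀ v ∈ M, ρ g v ∈ M) {v : V} (hv : v ∈ M) : charSum ρ φ v ∈ M := by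
  rw [charSum, LinearMap.sum_apply]
  exact M.sum_mem fun a _ => M.smul_mem _ (hM _ _ hv)

/-- For `φ = ψ`, the operator `charSum` is `|A|` times the restriction of functions to `H_ψ ⋉ A`. -/
theorem charSum_eq_inducedSingle [Fintype A] (F : LittleGroupSpace ψ σ) :
    charSum (littleGroupRep ψ σ) ψ F = (Fintype.card A : ℂ) • inducedSingle _ (F.1 1) := by
  rw [eq_inducedSingle (charSum (littleGroupRep ψ σ) ψ F) fun g hg =>
    charSum_littleGroupRep_of_ne F fun h => hg (mem_sdpFull.2 h),
    charSum_littleGroupRep_of_eq F (charConj_one ψ), map_smul]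

/-- The element of `LittleGroupSpace ψ σ` supported on `H_ψ ⋉ A` with value `v` at `1`. -/
abbrev littleGroupSingle (ψ : AddChar A Circle) (σ : Representation ℂ (charStab H ψ) V) :
    V →ₗ[ℂ] LittleGroupSpace ψ σ :=
  inducedSingle (extTensor (charBar ψ) (charStab H ψ) (charStab_charBar ψ).ge σ)

theorem littleGroupSingle_rep (s : charStab H ψ) (v : V) :
    littleGroupSingle ψ σ (σ s v) = littleGroupRep ψ σ (SDP.inr A s) (littleGroupSingle ψ σ v) := by
  have h := inducedSingle_rep (σ := extTensor (charBar ψ) (charStab H ψ)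
    (charStab_charBar ψ).ge σ) ⟨SDP.inr A s, mem_sdpFull.2 s.2⟩ v
  have h' : extTensor (charBar ψ) (charStab H ψ) (charStab_charBar ψ).ge σ
      ⟨SDP.inr A s, mem_sdpFull.2 s.2⟩ v = σ s v := by
    change ((charBar ψ 0 : Circle) : ℂ) • σ s v = σ s v
    simp
  rw [← h', h]
  rfl

instance [Finite H] [Finite A] : Finite (SDP H A) :=
  Finite.of_equiv _ SemidirectProduct.equivProd.symm

instance [Nontrivial V] : Nontrivial (LittleGroupSpace ψ σ) := by
  refine Function.Injective.nontrivial (f := littleGroupSingle ψ σ) fun v w h => ?_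
  rw [← inducedSingle_apply_one (σ := extTensor (charBar ψ) (charStab H ψ)
    (charStab_charBar ψ).ge σ) v, h, inducedSingle_apply_one]

/-- A nonzero invariant subspace contains, after a translation and a projection to the character
`ψ̄` of `A`, a nonzero function supported on `H_ψ ⋉ A`; by irreducibility of `σ` it contains all of
these, and they generate. -/
theorem littleGroupRep_isIrreducible [Finite H] [Finite A] (hσ : σ.IsIrreducible) :
    (littleGroupRep ψ σ).IsIrreducible := by
  cases nonempty_fintype A
  have := nontrivial_of_isIrreducible hσ
  have hA : (Fintype.card A : ℂ) ≠ 0 := Nat.cast_ne_zero.2 Fintype.card_ne_zero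
  refine isIrreducible_of_forall fun M hM F hF hF0 => ?_
  obtain ⟨g, hg⟩ : ∃ g, F.1 g ≠ 0 := by
    by_contra! h
    exact hF0 (Subtype.ext (funext h))
  have hsingle : littleGroupSingle ψ σ (F.1 g) ∈ M := by
    have h1 := charSum_mem (φ := ψ) M hM (hM g⁻¹ F hF)
    rw [charSum_eq_inducedSingle, littleGroupRep_apply, inv_inv, mul_one] at h1
    exact (M.smul_mem_iff hA).1 h1
  have htop : M.comap (littleGroupSingle ψ σ) = ⊤ := by
    refine eq_top_of_isIrreducible hσ _ (fun s v hv => ?_) (v := F.1 g) hsingle hg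
    rw [Submodule.mem_comap, littleGroupSingle_rep]
    exact hM _ _ hv
  refine eq_top_of_inducedSingle_mem M hM fun v => ?_
  rw [← Submodule.mem_comap, htop]
  exact Submodule.mem_top

theorem conjRep_isIrreducible {h : H} (e : charConj h ψ = φ) (hσ : σ.IsIrreducible) :
    (conjRep h (charStab_conj e) σ).IsIrreducible := by
  have := nontrivial_of_isIrreducible hσ
  refine isIrreducible_of_forall fun M hM v hv hv0 => ?_
  refine eq_top_of_isIrreducible hσ M (fun s w hw => ?_) hv hv0
  have ht : h * s * h⁻¹ ∈ charStab H φ := by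
    rw [charStab_conj e]
    exact ⟨s, s.2, rfl⟩
  have h1 := hM ⟨_, ht⟩ w hw
  have h2 : conjRep h (charStab_conj e) σ ⟨_, ht⟩ = σ s :=
    congrArg σ (Subtype.ext (by simp [mul_assoc]))
  rwa [h2] at h1

/-- Conjugate data give equivalent representations of `H ⋉ A`, by right translation by `h`. -/
theorem littleGroupRep_equivalent_of_conj [Finite H] [Finite A] (hσ : σ.IsIrreducible)
    (hτ : τ.IsIrreducible) (h : H) (e : charConj h ψ = φ)
    (hστ : Equivalent (conjRep h (charStab_conj e) σ) τ) :
    Equivalent (littleGroupRep ψ σ) (littleGroupRep φ τ) := by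
  obtain ⟨E, hE⟩ := hστ.exists_linearEquiv
  have hmem : ∀ F : LittleGroupSpace ψ σ,
      (fun g => E (F.1 (g * SDP.inr A h))) ∈ LittleGroupSpace φ τ := by
    refine fun F => mem_littleGroupSpace (fun g a => ?_) (fun g t => ?_)
    · rw [mul_assoc, SDP.inl_mul, ← mul_assoc, LittleGroupSpace.apply_mul_inl, map_smul,
        ← e, charConj_apply, SDP.right_inr]
    · rw [← hE]
      have hs : h⁻¹ * t * h ∈ charStab H ψ := conj_mem_charStab e t
      have h1 : g * SDP.inr A (t : H) * SDP.inr A h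
          = g * SDP.inr A h * SDP.inr A ((⟨_, hs⟩ : charStab H ψ) : H) := by
        rw [mul_assoc, mul_assoc, ← SDP.inr_mul, ← SDP.inr_mul]
        simp [mul_assoc]
      rw [h1, LittleGroupSpace.apply_mul_inr]
      congr 1
      refine congrArg (fun s => σ s _) (Subtype.ext ?_)
      simp [mul_assoc]
  let T : LittleGroupSpace ψ σ →ₗ[ℂ] LittleGroupSpace φ τ :=
    { toFun F := ⟨_, hmem F⟩
      map_add' F F' := Subtype.ext (funext fun g => map_add E _ _)
      map_smul' c F := Subtype.ext (funext fun g => map_smul E c _) }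
  have := nontrivial_of_isIrreducible hσ
  obtain ⟨F, hF⟩ := exists_ne (0 : LittleGroupSpace ψ σ)
  refine equivalent_of_ne_zero (littleGroupRep_isIrreducible hσ) (littleGroupRep_isIrreducible hτ)
    T (fun g F => Subtype.ext (funext fun x => ?_)) (v := F) fun h0 => hF ?_
  · change E (F.1 (g⁻¹ * (x * SDP.inr A h))) = E (F.1 (g⁻¹ * x * SDP.inr A h))
    rw [mul_assoc]
  · apply Subtype.ext
    funext g
    have h1 := congrFun (congrArg Subtype.val h0) (g * (SDP.inr A h)⁻¹)
    change E (F.1 (g * (SDP.inr A h)⁻¹ * SDP.inr A h)) = 0 at h1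
    rw [inv_mul_cancel_right] at h1
    exact E.map_eq_zero_iff.1 h1

/-- Equivalent representations have conjugate data: comparing the characters of `A` that occur
gives `h`, and `v ↦ (T δ_v)(h⁻¹)`, where `T` is the equivalence and `δ_v` the function supported on
`H_ψ ⋉ A` with value `v` at `1`, is an intertwining map `ʰσ → τ`. -/
theorem exists_conj_of_littleGroupRep_equivalent [Finite A] (hσ : σ.IsIrreducible)
    (hτ : τ.IsIrreducible) (hστ : Equivalent (littleGroupRep ψ σ) (littleGroupRep φ τ)) :
    ∃ (h : H) (e : charConj h ψ = φ), Equivalent (conjRep h (charStab_conj e) σ) τ := by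
  cases nonempty_fintype A
  obtain ⟨T, hT⟩ := hστ.exists_linearEquiv
  have := nontrivial_of_isIrreducible hσ
  have hA : (Fintype.card A : ℂ) ≠ 0 := Nat.cast_ne_zero.2 Fintype.card_ne_zero
  obtain ⟨v, hv⟩ := exists_ne (0 : V)
  obtain ⟨g, hg⟩ : ∃ g, (T (littleGroupSingle ψ σ v)).1 g ≠ 0 := by
    by_contra! h
    have h1 : T (littleGroupSingle ψ σ v) = 0 := Subtype.ext (funext h)
    rw [T.map_eq_zero_iff] at h1
    apply hv
    rw [← inducedSingle_apply_one (σ := extTensor (charBar ψ) (charStab H ψ)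
      (charStab_charBar ψ).ge σ) v, h1]
    rfl
  -- `A` acts on `T δ_v` by `ψ̄`, so `T δ_v` is supported on those `g` that carry `φ` to `ψ`
  have hgψ : charConj g.right φ = ψ := by
    by_contra hne
    have h1 := map_charSum (φ := ψ) T.toLinearMap hT (littleGroupSingle ψ σ v)
    rw [charSum_eq_inducedSingle, inducedSingle_apply_one, map_smul] at h1
    have h2 := congrFun (congrArg Subtype.val h1) g
    refine smul_ne_zero hA hg (h2.trans ?_)
    exact charSum_littleGroupRep_of_ne _ hne
  set h : H := g.right⁻¹ with hh
  have e : charConj h ψ = φ := by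
    rw [← hgψ, ← charConj_mul, hh, inv_mul_cancel, charConj_one]
  refine ⟨h, e, equivalent_of_ne_zero (conjRep_isIrreducible e hσ) hτ
    { toFun w := (T (littleGroupSingle ψ σ w)).1 (SDP.inr A h⁻¹)
      map_add' w w' := by simp only [map_add]; rfl
      map_smul' c w := by simp only [map_smul]; rfl } (fun t w => ?_) (v := v) fun h0 => hg ?_⟩
  · have ht : h⁻¹ * t * h ∈ charStab H ψ := conj_mem_charStab e t
    change (T (littleGroupSingle ψ σ (σ ⟨_, ht⟩ w))).1 (SDP.inr A h⁻¹) =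
      τ t ((T (littleGroupSingle ψ σ w)).1 (SDP.inr A h⁻¹))
    have h1 := LittleGroupSpace.apply_mul_inr (T (littleGroupSingle ψ σ w)) (SDP.inr A h⁻¹) t⁻¹
    rw [inv_inv t] at h1
    rw [littleGroupSingle_rep, hT, littleGroupRep_apply, ← h1, ← SDP.inr_inv, ← SDP.inr_mul,
      ← SDP.inr_mul]
    simp [mul_assoc]
  · have h1 : SDP.inr A h⁻¹ * SDP.inl H (g.right⁻¹ • g.vec) = g := by
      rw [hh, inv_inv, SDP.inr_mul_inl]
    rw [← h1, LittleGroupSpace.apply_mul_inl]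
    exact smul_eq_zero_of_right _ h0

theorem littleGroupRep_equivalent_iff [Finite H] [Finite A] (hσ : σ.IsIrreducible)
    (hτ : τ.IsIrreducible) : Equivalent (littleGroupRep ψ σ) (littleGroupRep φ τ) ↔
      ∃ (h : H) (e : charConj h ψ = φ), Equivalent (conjRep h (charStab_conj e) σ) τ :=
  ⟨exists_conj_of_littleGroupRep_equivalent hσ hτ,
    fun ⟨h, e, he⟩ => littleGroupRep_equivalent_of_conj hσ hτ h e he⟩

end LittleGroup

/-! ### Fourier coefficients and the decomposition of the induced representation -/

section Decomposition

variable {H A : Type*} [Group H] [AddCommGroup A] [DistribMulAction H A] {K : Subgroup H}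
  {C : AddSubgroup A} {hC : ∀ k ∈ K, ∀ c ∈ C, k • c ∈ C} {ψ : AddChar A Circle}

/-- The functions on `H ⋉ A` that are invariant under right multiplication by `K ⋉ C`. -/
abbrev InvariantSpace (K : Subgroup H) (C : AddSubgroup A)
    (hC : ∀ k ∈ K, ∀ c ∈ C, k • c ∈ C) : Submodule ℂ (SDP H A → ℂ) :=
  inducedSpace (sdpSubgroup K C hC) (Representation.trivial ℂ (sdpSubgroup K C hC) ℂ)

theorem InvariantSpace.apply_mul_inl (F : InvariantSpace K C hC) (g : SDP H A) {c : A}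
    (hc : c ∈ C) : F.1 (g * SDP.inl H c) = F.1 g :=
  F.2 g ⟨SDP.inl H c, K.one_mem, hc⟩

theorem InvariantSpace.apply_mul_inr (F : InvariantSpace K C hC) (g : SDP H A) {k : H}
    (hk : k ∈ K) : F.1 (g * SDP.inr A k) = F.1 g :=
  F.2 g ⟨SDP.inr A k, hk, C.zero_mem⟩

theorem card_sdpSubgroup :
    Nat.card (sdpSubgroup K C hC) = Nat.card K * Nat.card C := by
  rw [← Nat.card_prod]
  exact Nat.card_congr
    { toFun g := (⟨g.1.right, g.2.1⟩, ⟨g.1.vec, g.2.2⟩)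
      invFun p := ⟨SDP.inl H (p.2 : A) * SDP.inr A (p.1 : H), by
        constructor <;> simp⟩
      left_inv g := Subtype.ext (SDP.inl_mul_inr g.1)
      right_inv p := by simp }

theorem index_sdpSubgroup [Finite H] [Finite A] :
    (sdpSubgroup K C hC).index = K.index * C.index := by
  have h1 : Nat.card (sdpSubgroup K C hC) * (sdpSubgroup K C hC).index =
      Nat.card H * Nat.card A := by
    rw [Subgroup.card_mul_index, ← Nat.card_prod, Nat.card_congr (SemidirectProduct.equivProd),
      Nat.card_prod, Nat.card_prod, mul_comm]
    rfl
  rw [card_sdpSubgroup, ← K.card_mul_index, ← C.card_mul_index] at h1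
  have hK : 0 < Nat.card K := Nat.card_pos
  have hC' : 0 < Nat.card C := Nat.card_pos
  refine Nat.eq_of_mul_eq_mul_left (Nat.mul_pos hK hC') (h1.trans ?_)
  ring

section FourierCoefficients

variable [Fintype A]

/-- The Fourier coefficient at `ψ` of the function `a ↦ F (g (1, a))` on `A`. -/
def fourierCoeff (ψ : AddChar A Circle) (g : SDP H A) : (SDP H A → ℂ) →ₗ[ℂ] ℂ where
  toFun F := ∑ a, F (g * SDP.inl H a) * ψ (-a)
  map_add' F F' := by simp [add_mul, Finset.sum_add_distrib]
  map_smul' c F := by simp [Finset.mul_sum, mul_assoc]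

theorem fourierCoeff_apply (g : SDP H A) (F : SDP H A → ℂ) :
    fourierCoeff ψ g F = ∑ a, F (g * SDP.inl H a) * ψ (-a) := rfl

theorem fourierCoeff_mul_inl (g : SDP H A) (b : A) (F : SDP H A → ℂ) :
    fourierCoeff ψ (g * SDP.inl H b) F = ψ b * fourierCoeff ψ g F := by
  simp only [fourierCoeff_apply, Finset.mul_sum]
  refine Fintype.sum_equiv (Equiv.addLeft b) _ _ fun a => ?_
  rw [Equiv.coe_addLeft, SDP.inl_add, mul_assoc, neg_add, AddChar.map_add_eq_mul, Circle.coe_mul,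
    mul_left_comm, ← mul_assoc (ψ b : ℂ), ← Circle.coe_mul, ← AddChar.map_add_eq_mul]
  simp

theorem fourierCoeff_mul_inr (g : SDP H A) {k : H} (hk : k ∈ K) (F : InvariantSpace K C hC) :
    fourierCoeff ψ (g * SDP.inr A k) F.1 = fourierCoeff (charConj k ψ) g F.1 := by
  simp only [fourierCoeff_apply]
  refine Fintype.sum_equiv (MulAction.toPerm k) _ _ fun a => ?_
  have h1 : SDP.inl H (k • a) * SDP.inr A k = SDP.inr A k * SDP.inl H a := by
    rw [SDP.inl_mul, SDP.right_inr, inv_smul_smul]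
  rw [MulAction.toPerm_apply, ← InvariantSpace.apply_mul_inr F (g * SDP.inl H (k • a)) hk,
    mul_assoc, mul_assoc, h1]
  simp

/-- The coefficients of a `K ⋉ C`-invariant function vanish at the characters that are nontrivial on
`C`. -/
theorem fourierCoeff_eq_zero {c : A} (hc : c ∈ C) (hψ : ψ c ≠ 1) (g : SDP H A)
    (F : InvariantSpace K C hC) : fourierCoeff ψ g F.1 = 0 := by
  have h1 : fourierCoeff ψ (g * SDP.inl H c) F.1 = fourierCoeff ψ g F.1 := by
    simp only [fourierCoeff_apply]
    refine Finset.sum_congr rfl fun a _ => ?_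
    rw [mul_assoc, ← SDP.inl_add, add_comm, SDP.inl_add, ← mul_assoc,
      InvariantSpace.apply_mul_inl F _ hc]
  rw [fourierCoeff_mul_inl] at h1
  by_contra h0
  exact hψ (Circle.ext (mul_right_cancel₀ h0 (h1.trans (one_mul _).symm)))

/-- Fourier inversion on `A`. -/
theorem eq_zero_of_fourierCoeff_eq_zero (g : SDP H A) (F : SDP H A → ℂ)
    (h : ∀ ψ, fourierCoeff ψ g F = 0) : F g = 0 := by
  classical
  have h1 : ∑ χ : AddChar A ℂ, ∑ a, F (g * SDP.inl H a) * χ (-a) = 0 := by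
    refine Finset.sum_eq_zero fun χ _ => ?_
    have := h (AddChar.circleEquivComplex.symm χ)
    rwa [fourierCoeff_apply] at this
  rw [Finset.sum_comm] at h1
  simp only [← Finset.mul_sum, AddChar.sum_apply_eq_ite, neg_eq_zero] at h1
  have h2 : SDP.inl H (0 : A) = 1 := rfl
  simpa [h2] using h1

/-- The coefficient at `g s` depends only on the coset of `s ∈ H_ψ` modulo `K_ψ`. -/
theorem fourierCoeff_out (g : SDP H A) (F : InvariantSpace K C hC) (s : charStab H ψ) :
    fourierCoeff ψ (g * SDP.inr A
      ((s : charStab H ψ ⧸ K.subgroupOf (charStab H ψ)).out : charStab H ψ).1) F.1 =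
      fourierCoeff ψ (g * SDP.inr A (s : H)) F.1 := by
  set s' := (s : charStab H ψ ⧸ K.subgroupOf (charStab H ψ)).out
  have hk : ((s⁻¹ * s' : charStab H ψ) : H) ∈ K :=
    Subgroup.mem_subgroupOf.1 (QuotientGroup.eq.1 (QuotientGroup.out_eq' _).symm)
  have hψ : charConj ((s⁻¹ * s' : charStab H ψ) : H) ψ = ψ := (s⁻¹ * s').2
  have h := fourierCoeff_mul_inr (ψ := ψ) (g * SDP.inr A (s : H)) hk F
  rw [hψ, mul_assoc, ← SDP.inr_mul] at h
  rw [← h]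
  simp

/-- The Fourier coefficients at `ψ` as a map from the `K ⋉ C`-invariant functions to the
representation attached to `ψ` and `L(H_ψ / K_ψ)`: the value of the image of `F` at `g` is the
function `s K_ψ ↦ ∑ₐ F (g s a) ψ̄(a)`. -/
def fourierMap (ψ : AddChar A Circle) (hC : ∀ k ∈ K, ∀ c ∈ C, k • c ∈ C) :
    InvariantSpace K C hC →ₗ[ℂ] LittleGroupSpace ψ
      (permRep (charStab H ψ) (charStab H ψ ⧸ K.subgroupOf (charStab H ψ))) where
  toFun F := ⟨fun g q => fourierCoeff ψ (g * SDP.inr A (q.out : H)) F.1,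
    mem_littleGroupSpace (fun g a => funext fun q => by
      have hq : charConj (q.out : H) ψ = ψ := q.out.2
      rw [mul_assoc, SDP.inl_mul, ← mul_assoc, fourierCoeff_mul_inl, SDP.right_inr,
        ← charConj_apply, hq]
      rfl) (fun g s => funext fun q => by
      obtain ⟨t, rfl⟩ := QuotientGroup.mk_surjective q
      rw [fourierCoeff_out, mul_assoc, ← SDP.inr_mul, ← Subgroup.coe_mul, ← fourierCoeff_out]
      change _ = fourierCoeff ψ (g * SDP.inr A ((s⁻¹⁻¹ • (t : charStab H ψ ⧸
        K.subgroupOf (charStab H ψ))).out : H)) F.1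
      rw [inv_inv]
      rfl)⟩
  map_add' F F' := Subtype.ext (funext fun g => funext fun q => map_add _ _ _)
  map_smul' c F := Subtype.ext (funext fun g => funext fun q => map_smul _ _ _)

theorem fourierMap_apply_one (g : SDP H A) (F : InvariantSpace K C hC) :
    (fourierMap ψ hC F).1 g ((1 : charStab H ψ) : charStab H ψ ⧸ K.subgroupOf (charStab H ψ)) =
      fourierCoeff ψ g F.1 := by
  refine (fourierCoeff_out g F 1).trans ?_
  have h1 : SDP.inr A ((1 : charStab H ψ) : H) = 1 := rfl
  rw [h1, mul_one]

theorem fourierCoeff_mul_left (g x : SDP H A) (F : SDP H A → ℂ) :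
    fourierCoeff ψ x (fun y => F (g * y)) = fourierCoeff ψ (g * x) F := by
  simp only [fourierCoeff_apply, mul_assoc]

theorem fourierMap_induced (g : SDP H A) (F : InvariantSpace K C hC) :
    fourierMap ψ hC (induced _ _ g F) = littleGroupRep ψ _ g (fourierMap ψ hC F) := by
  apply Subtype.ext
  funext x q
  refine (fourierCoeff_mul_left g⁻¹ _ F.1).trans ?_
  rw [← mul_assoc]
  rfl

end FourierCoefficients

/-- The decomposition of the representation of `H ⋉ A` induced by the trivial representation of
`K ⋉ C`, for a family `ψ` of characters of `A` that meets every `K`-orbit of characters trivial on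
`C`, the lengths of the `K`-orbits of the `ψ θ` adding up to the number of those characters. The
Fourier coefficients at the `ψ θ` give an injective intertwining map; it is bijective since the
dimensions agree. -/
theorem induced_equivalent_directSum [Finite H] [Finite A] {Θ : Type*} [Fintype Θ]
    (ψ : Θ → AddChar A Circle)
    {J : Θ → Type*} [∀ θ, Fintype (J θ)] {U : (θ : Θ) → J θ → Type*}
    [∀ θ j, AddCommGroup (U θ j)] [∀ θ j, Module ℂ (U θ j)] [∀ θ j, FiniteDimensional ℂ (U θ j)]
    (σ : (θ : Θ) → (j : J θ) → Representation ℂ (charStab H (ψ θ)) (U θ j))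
    (hdec : ∀ θ, Equivalent
      (permRep (charStab H (ψ θ)) (charStab H (ψ θ) ⧸ K.subgroupOf (charStab H (ψ θ))))
      (Representation.directSum (σ θ)))
    (hcover : ∀ χ : AddChar A Circle, (∀ c ∈ C, χ c = 1) → ∃ θ, ∃ k ∈ K, charConj k (ψ θ) = χ)
    (hcard : ∑ θ, (charStab H (ψ θ)).relIndex K = C.index) :
    Equivalent (induced (sdpSubgroup K C hC) (Representation.trivial ℂ (sdpSubgroup K C hC) ℂ))
      (Representation.directSum
        (fun i : Σ θ, J θ => littleGroupRep (ψ i.1) (σ i.1 i.2))) := by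
  cases nonempty_fintype A
  choose E hE using fun θ => (hdec θ).exists_linearEquiv
  let D := DirectSum.linearEquivFunOnFintype ℂ (Σ θ, J θ)
    (fun i => LittleGroupSpace (ψ i.1) (σ i.1 i.2))
  have hEinv : ∀ θ s f j, (E θ (permRep _ _ s f)) j = σ θ j s (E θ f j) := by
    intro θ s f j
    rw [hE]
    rfl
  let T : InvariantSpace K C hC →ₗ[ℂ] ∀ i : Σ θ, J θ, LittleGroupSpace (ψ i.1) (σ i.1 i.2) :=
    { toFun F i := ⟨fun g => E i.1 ((fourierMap (ψ i.1) hC F).1 g) i.2,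
        mem_littleGroupSpace
          (fun g a => by
            rw [LittleGroupSpace.apply_mul_inl, map_smul]
            rfl)
          (fun g s => by rw [LittleGroupSpace.apply_mul_inr, hEinv])⟩
      map_add' F F' := by
        funext i
        apply Subtype.ext
        funext g
        simp
      map_smul' c F := by
        funext i
        apply Subtype.ext
        funext g
        change E i.1 ((fourierMap (ψ i.1) hC (c • F)).1 g) i.2 =
          c • E i.1 ((fourierMap (ψ i.1) hC F).1 g) i.2
        rw [map_smul, Submodule.coe_smul, Pi.smul_apply, map_smul]
        rfl }
  have hinj : Function.Injective T := by
    rw [← LinearMap.ker_eq_bot, LinearMap.ker_eq_bot']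
    intro F hF
    have hzero : ∀ θ g, fourierCoeff (ψ θ) g F.1 = 0 := by
      intro θ g
      have h1 : E θ ((fourierMap (ψ θ) hC F).1 g) = 0 := by
        refine DFinsupp.ext fun j => ?_
        exact congrFun (congrArg Subtype.val (congrFun hF ⟨θ, j⟩)) g
      rw [LinearEquiv.map_eq_zero_iff] at h1
      rw [← fourierMap_apply_one, h1]
      rfl
    apply Subtype.ext
    funext g
    refine eq_zero_of_fourierCoeff_eq_zero g F.1 fun χ => ?_
    by_cases hχ : ∀ c ∈ C, χ c = 1
    · obtain ⟨θ, k, hk, rfl⟩ := hcover χ hχ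
      rw [← fourierCoeff_mul_inr g hk, hzero]
    · push Not at hχ
      obtain ⟨c, hc, hχc⟩ := hχ
      exact fourierCoeff_eq_zero hc hχc g F
  have hdim : Module.finrank ℂ (InvariantSpace K C hC) =
      Module.finrank ℂ (∀ i : Σ θ, J θ, LittleGroupSpace (ψ i.1) (σ i.1 i.2)) := by
    have hU : ∀ θ, ∑ j, Module.finrank ℂ (U θ j) = K.relIndex (charStab H (ψ θ)) := by
      intro θ
      classical
      cases nonempty_fintype (charStab H (ψ θ) ⧸ K.subgroupOf (charStab H (ψ θ)))
      rw [← Module.finrank_directSum, ← (E θ).finrank_eq, Module.finrank_fintype_fun_eq_card,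
        Subgroup.relIndex, Subgroup.index, Nat.card_eq_fintype_card]
    -- both sides are `[H : H_θ ∩ K]`
    have hindex : ∀ θ, (sdpFull A (charStab H (ψ θ))).index * K.relIndex (charStab H (ψ θ)) =
        K.index * (charStab H (ψ θ)).relIndex K := by
      intro θ
      rw [index_sdpSubgroup, AddSubgroup.index_top, mul_one, mul_comm, mul_comm K.index,
        ← Subgroup.inf_relIndex_right, Subgroup.relIndex_mul_index inf_le_right,
        ← Subgroup.inf_relIndex_left, Subgroup.relIndex_mul_index inf_le_left]
    rw [finrank_inducedSpace, Module.finrank_self, mul_one, index_sdpSubgroup,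
      Module.finrank_pi_fintype, Fintype.sum_sigma, ← hcard, Finset.mul_sum]
    refine Finset.sum_congr rfl fun θ _ => ?_
    simp only [finrank_inducedSpace]
    rw [← Finset.mul_sum, hU, hindex]
  refine .of_linearEquiv ((LinearEquiv.ofBijective T
    ⟨hinj, (LinearMap.injective_iff_surjective_of_finrank_eq_finrank hdim).1 hinj⟩).trans D.symm) ?_
  intro g F
  refine DFinsupp.ext fun i => ?_
  refine (congrFun (D.apply_symm_apply (T (induced _ _ g F))) i).trans ?_
  refine Eq.trans ?_ (congrArg (littleGroupRep (ψ i.1) (σ i.1 i.2) g)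
    (congrFun (D.apply_symm_apply (T F)) i)).symm
  apply Subtype.ext
  funext x
  change E i.1 ((fourierMap (ψ i.1) hC (induced _ _ g F)).1 x) i.2 = _
  rw [fourierMap_induced]
  rfl

end Decomposition

/-! ### Characters and orbits of a fiber system -/

theorem card_addChar_circle (M : Type*) [AddCommGroup M] [Finite M] :
    Nat.card (AddChar M Circle) = Nat.card M := by
  classical
  cases nonempty_fintype M
  rw [Nat.card_congr AddChar.circleEquivComplex.toEquiv, Nat.card_eq_fintype_card,
    Nat.card_eq_fintype_card, AddChar.card_eq]

namespace FiberSystem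

variable {H A Y : Type*} [Group H] [AddCommGroup A] [DistribMulAction H A] [MulAction H Y]
  {B : Y → Type*} [∀ y, AddCommGroup (B y)]

theorem infl_injective (S : FiberSystem H A Y B) {y₀ : Y} :
    Function.Injective (S.infl : AddChar (B y₀) Circle → AddChar A Circle) := by
  intro θ θ' h
  refine DFunLike.ext _ _ fun b => ?_
  obtain ⟨a, rfl⟩ := S.proj_surjective y₀ b
  exact DFunLike.congr_fun h a

theorem cast_proj (S : FiberSystem H A Y B) {y y' : Y} (h : y = y') (a : A) :
    AddEquiv.cast (M := B) h (S.proj y a) = S.proj y' a := by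
  subst h
  rfl

theorem infl_dualConj (S : FiberSystem H A Y B) {y₀ : Y} (k : MulAction.stabilizer H y₀)
    (θ : AddChar (B y₀) Circle) : S.infl (S.dualConj k θ) = charConj (k : H) (S.infl θ) := by
  refine DFunLike.ext _ _ fun a => ?_
  have hk : (k⁻¹ : H) • y₀ = y₀ := (k⁻¹).2
  exact congrArg θ ((congrArg (AddEquiv.cast (M := B) hk) (S.act_proj _ y₀ a)).trans
    (S.cast_proj hk _))

/-- A character of `A` that is trivial on `C` is inflated from `B`. -/
theorem exists_infl_eq (S : FiberSystem H A Y B) {y₀ : Y} {χ : AddChar A Circle}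
    (hχ : ∀ c ∈ S.ker y₀, χ c = 1) : ∃ θ : AddChar (B y₀) Circle, S.infl θ = χ := by
  let f : B y₀ →+ Additive Circle := (S.proj y₀).liftOfSurjective (S.proj_surjective y₀)
    ⟨AddChar.toAddMonoidHomEquiv χ, fun c hc => hχ c hc⟩
  refine ⟨AddChar.toAddMonoidHomEquiv.symm f, DFunLike.ext _ _ fun a => ?_⟩
  exact AddMonoidHom.liftOfRightInverse_comp_apply _ _
    (Function.rightInverse_surjInv (S.proj_surjective y₀))
    ⟨AddChar.toAddMonoidHomEquiv χ, fun c hc => hχ c hc⟩ a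

/-- The action `(k, θ) ↦ ᵏθ` of `K` on the dual of `B`. -/
abbrev dualAction (S : FiberSystem H A Y B) (y₀ : Y) :
    MulAction (MulAction.stabilizer H y₀) (AddChar (B y₀) Circle) where
  smul k θ := S.dualConj k θ
  one_smul θ := S.infl_injective ((S.infl_dualConj 1 θ).trans (charConj_one _))
  mul_smul k k' θ := S.infl_injective <| by
    change S.infl (S.dualConj (k * k') θ) = S.infl (S.dualConj k (S.dualConj k' θ))
    simp only [infl_dualConj, Subgroup.coe_mul, charConj_mul]

/-- The index `[K : K_θ]` is the length of the `K`-orbit of `θ`. -/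
theorem relIndex_Hstab (S : FiberSystem H A Y B) {y₀ : Y} (θ : AddChar (B y₀) Circle) :
    (S.Hstab θ).relIndex (MulAction.stabilizer H y₀) =
      Nat.card {χ : AddChar (B y₀) Circle // ∃ k, S.dualConj k θ = χ} := by
  let _ := S.dualAction y₀
  refine Eq.trans ?_ (MulAction.index_stabilizer (MulAction.stabilizer H y₀) θ)
  rw [Subgroup.relIndex]
  congr 1
  ext k
  rw [Subgroup.mem_subgroupOf, mem_charStab, ← infl_dualConj, S.infl_injective.eq_iff]
  rfl

theorem index_ker (S : FiberSystem H A Y B) (y₀ : Y) : (S.ker y₀).index = Nat.card (B y₀) := by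
  rw [ker, AddSubgroup.index_ker]
  exact Nat.card_congr ((Equiv.setCongr (by simp [S.proj_surjective y₀])).trans (Equiv.Set.univ _))

theorem finite_fiber [Finite A] (S : FiberSystem H A Y B) (y : Y) : Finite (B y) :=
  Finite.of_surjective _ (S.proj_surjective y)

/-- The `K`-orbits of the elements of `Θ` partition the dual of `B`, which has `[A : C]`
elements. -/
theorem sum_relIndex_Hstab [Finite A] (S : FiberSystem H A Y B) {y₀ : Y}
    {Θ : Finset (AddChar (B y₀) Circle)} (hΘ : S.IsKOrbitReps Θ) :
    ∑ θ : Θ, (S.Hstab θ.1).relIndex (MulAction.stabilizer H y₀) = (S.ker y₀).index := by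
  have := S.finite_fiber y₀
  have : Finite (AddChar (B y₀) Circle) := Finite.of_equiv _ AddChar.circleEquivComplex.symm.toEquiv
  simp only [relIndex_Hstab]
  rw [index_ker, ← card_addChar_circle, ← Nat.card_sigma]
  refine Nat.card_eq_of_bijective (fun p => p.2.1) ⟨?_, fun χ => ?_⟩
  · rintro ⟨θ, χ, h⟩ ⟨θ', χ', h'⟩ (rfl : χ = χ')
    obtain rfl : θ = θ' := Subtype.ext ((hΘ χ).unique ⟨θ.2, h⟩ ⟨θ'.2, h'⟩)
    rfl
  · obtain ⟨θ, ⟨hθ, h⟩, -⟩ := hΘ χ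
    exact ⟨⟨⟨θ, hθ⟩, χ, h⟩, rfl⟩

theorem exists_charConj_infl (S : FiberSystem H A Y B) {y₀ : Y}
    {Θ : Finset (AddChar (B y₀) Circle)} (hΘ : S.IsKOrbitReps Θ) (χ : AddChar A Circle)
    (hχ : ∀ c ∈ S.ker y₀, χ c = 1) :
    ∃ θ : Θ, ∃ k ∈ MulAction.stabilizer H y₀, charConj k (S.infl θ.1) = χ := by
  obtain ⟨θ', rfl⟩ := S.exists_infl_eq hχ
  obtain ⟨θ, ⟨hθ, k, rfl⟩, -⟩ := hΘ θ'
  exact ⟨⟨θ, hθ⟩, k, k.2, (S.infl_dualConj k θ).symm⟩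

/-- The point `(y, b)` of `X`. -/
def point (S : FiberSystem H A Y B) (y : Y) (b : B y) : S.Total := ⟨y, b⟩

theorem smul_point_zero (S : FiberSystem H A Y B) (g : SDP H A) (y : Y) :
    g • S.point y 0 = S.point (g.right • y) (S.proj (g.right • y) g.vec) := by
  change S.point (g.right • y) (S.proj (g.right • y) g.vec + S.act g.right y 0) = _
  rw [map_zero, add_zero]

instance [MulAction.IsPretransitive H Y] (S : FiberSystem H A Y B) :
    MulAction.IsPretransitive (SDP H A) S.Total := by
  refine ⟨?_⟩
  have key : ∀ (y : Y) (x : S.Total), ∃ g : SDP H A, g • S.point y 0 = x := by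
    rintro y ⟨z, b⟩
    obtain ⟨h, rfl⟩ := MulAction.exists_smul_eq H y z
    obtain ⟨a, rfl⟩ := S.proj_surjective _ b
    exact ⟨⟨Multiplicative.ofAdd a, h⟩, S.smul_point_zero _ y⟩
  intro x x'
  obtain ⟨g, hg⟩ := key x.1 x
  obtain ⟨g', hg'⟩ := key x.1 x'
  exact ⟨g' * g⁻¹, by rw [mul_smul, inv_smul_eq_iff.2 hg.symm, hg']⟩

theorem stabilizer_base (S : FiberSystem H A Y B) (y₀ : Y) :
    MulAction.stabilizer (SDP H A) (S.point y₀ 0) = S.KC y₀ := by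
  ext g
  rw [MulAction.mem_stabilizer_iff, smul_point_zero]
  have key : ∀ y, S.point y (S.proj y g.vec) = S.point y₀ 0 ↔ y = y₀ ∧ S.proj y₀ g.vec = 0 := by
    intro y
    constructor
    · intro h
      obtain ⟨rfl, h⟩ := Sigma.mk.inj h
      exact ⟨rfl, eq_of_heq h⟩
    · rintro ⟨rfl, h⟩
      rw [h]
  exact key _

/-- As `K ≤ H`, it suffices that the inflation of `θ` itself lies in the `H`-orbit. -/
theorem mem_orbitClass (S : FiberSystem H A Y B) {y₀ : Y} {Θ : Finset (AddChar (B y₀) Circle)}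
    {ξ θ : AddChar (B y₀) Circle} :
    θ ∈ S.orbitClass Θ ξ ↔ θ ∈ Θ ∧ ∃ h : H, charConj h (S.infl ξ) = S.infl θ := by
  classical
  rw [orbitClass, Finset.mem_filter]
  refine and_congr_right fun _ => ⟨fun h => h ⟨1, one_mem _, charConj_one _⟩, ?_⟩
  rintro ⟨h, hh⟩ _ ⟨k, -, rfl⟩
  exact ⟨k * h, by rw [charConj_mul, hh]⟩

/-- The conjugates of a trivial representation are trivial. -/
theorem conjugatePair_trivial_iff (S : FiberSystem H A Y B) {y₀ : Y}
    {ξ θ : AddChar (B y₀) Circle} {W : Type*} [AddCommGroup W] [Module ℂ W]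
    {τ : Representation ℂ (S.Hstab θ) W} :
    S.ConjugatePair ξ θ (Representation.trivial ℂ (S.Hstab ξ) ℂ) τ ↔
      (∃ h : H, charConj h (S.infl ξ) = S.infl θ) ∧
        Equivalent (Representation.trivial ℂ (S.Hstab θ) ℂ) τ :=
  ⟨fun ⟨h, e, hτ⟩ => ⟨⟨h, e⟩, hτ⟩, fun ⟨⟨h, e⟩, hτ⟩ => ⟨h, e, hτ⟩⟩

open scoped Classical in
/-- By Schur's lemma, multiplicities in a sum of irreducible little group representations count
the conjugate pairs. -/
theorem multiplicity_littleGroupRep [Finite H] [Finite A] (S : FiberSystem H A Y B) {y₀ : Y}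
    {Θ : Finset (AddChar (B y₀) Circle)} {n : Θ → ℕ} {m : (θ : Θ) → Fin (n θ + 1) → ℕ}
    {U : (θ : Θ) → Fin (n θ + 1) → Type*}
    [∀ θ j, AddCommGroup (U θ j)] [∀ θ j, Module ℂ (U θ j)]
    {σ : (θ : Θ) → (j : Fin (n θ + 1)) → Representation ℂ (S.Hstab θ.1) (U θ j)}
    (hirr : ∀ (θ : Θ) (j : Fin (n θ + 1)), (σ θ j).IsIrreducible)
    {W : Type*} [AddCommGroup W] [Module ℂ W] {ρ : Representation ℂ (SDP H A) W}
    (hρ : Equivalent ρ (Representation.directSum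
        (fun i : (Σ θ : Θ, Σ j : Fin (n θ + 1), Fin (m θ j)) =>
          littleGroupRep (S.infl i.1.1) (σ i.1 i.2.1))))
    {ξ : AddChar (B y₀) Circle} {V : Type*} [AddCommGroup V] [Module ℂ V]
    {τ : Representation ℂ (S.Hstab ξ) V} (hτ : τ.IsIrreducible) :
    multiplicity (littleGroupRep (S.infl ξ) τ) ρ =
      ∑ θ : Θ, ∑ j : Fin (n θ + 1), if S.ConjugatePair ξ θ.1 τ (σ θ j) then m θ j else 0 := by
  rw [multiplicity_of_equivalent_directSum (littleGroupRep_isIrreducible hτ) hρ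
    fun i => littleGroupRep_isIrreducible (hirr i.1 i.2.1), Fintype.sum_sigma]
  refine Finset.sum_congr rfl fun θ _ => ?_
  rw [Fintype.sum_sigma]
  refine Finset.sum_congr rfl fun j _ => ?_
  have h : Equivalent (littleGroupRep (S.infl ξ) τ) (littleGroupRep (S.infl θ.1) (σ θ j)) ↔
      S.ConjugatePair ξ θ.1 τ (σ θ j) := littleGroupRep_equivalent_iff hτ (hirr θ j)
  simp [h]

end FiberSystem

open scoped Classical in
/-- In a decomposition of the permutation representation of a transitive action, the trivial
representation has coefficient `1`. -/
theorem multiplicity_of_trivial_eq_one {G X : Type*} [Group G] [Finite G] [MulAction G X]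
    [MulAction.IsPretransitive G X] [Nonempty X] {n : ℕ} {m : Fin (n + 1) → ℕ}
    {U : Fin (n + 1) → Type*} [∀ j, AddCommGroup (U j)] [∀ j, Module ℂ (U j)]
    {σ : (j : Fin (n + 1)) → Representation ℂ G (U j)} (hirr : ∀ j, (σ j).IsIrreducible)
    (hdec : Equivalent (permRep G X)
      (Representation.directSum (fun i : (Σ j : Fin (n + 1), Fin (m j)) => σ i.1)))
    {j₀ : Fin (n + 1)}
    (hj₀ : ∀ j, Equivalent (Representation.trivial ℂ G ℂ) (σ j) ↔ j = j₀) : m j₀ = 1 := by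
  have h := multiplicity_trivial_permRep (G := G) (X := X)
  rw [multiplicity_of_equivalent_directSum isIrreducible_trivial hdec
    fun i => hirr i.1, Fintype.sum_sigma] at h
  simpa [hj₀, apply_ite] using h

end SemidirectPerm

end

open SemidirectPerm in
open scoped Classical in
theorem mainTheorem1
    {H A Y : Type*} [Group H] [Finite H] [AddCommGroup A] [Finite A] [DistribMulAction H A]
    [MulAction H Y] [MulAction.IsPretransitive H Y] {B : Y → Type*} [∀ y, AddCommGroup (B y)]
    (S : FiberSystem H A Y B) (y₀ : Y)
    (Θ Ξ : Finset (AddChar (B y₀) Circle))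
    (hΘ : S.IsKOrbitReps Θ) (hΞ : S.IsHOrbitReps Θ Ξ)
    (n : Θ → ℕ) (m : (θ : Θ) → Fin (n θ + 1) → ℕ)
    (U : (θ : Θ) → Fin (n θ + 1) → Type*)
    [∀ θ j, AddCommGroup (U θ j)] [∀ θ j, Module ℂ (U θ j)]
    (σ : (θ : Θ) → (j : Fin (n θ + 1)) → Representation ℂ (S.Hstab θ.1) (U θ j))
    (hirr : ∀ (θ : Θ) (j : Fin (n θ + 1)), (σ θ j).IsIrreducible)
    (hineq : ∀ θ i j, Equivalent (σ θ i) (σ θ j) → i = j)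
    (hpos : ∀ θ j, 0 < m θ j)
    (hdec : ∀ θ : Θ, Equivalent
      (permRep (S.Hstab θ.1) (S.Hstab θ.1 ⧸ S.Kstab θ.1))
      (Representation.directSum
        (fun i : (Σ j : Fin (n θ + 1), Fin (m θ j)) => σ θ i.1)))
    (htriv : ∀ θ, Equivalent (σ θ 0) (Representation.trivial ℂ (S.Hstab θ.1) ℂ)) :
    -- the permutation representation on `L(X)` and the induced representation agree,
    Equivalent (permRep (SDP H A) S.Total)
      (induced (S.KC y₀) (Representation.trivial ℂ (S.KC y₀) ℂ)) ∧
    -- they decompose as stated,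
    Equivalent (induced (S.KC y₀) (Representation.trivial ℂ (S.KC y₀) ℂ))
      (Representation.directSum
        (fun i : (Σ θ : Θ, Σ j : Fin (n θ + 1), Fin (m θ j)) =>
          littleGroupRep (S.infl i.1.1) (σ i.1 i.2.1))) ∧
    -- the summands are irreducible,
    (∀ (θ : Θ) (j : Fin (n θ + 1)), (littleGroupRep (S.infl θ.1) (σ θ j)).IsIrreducible) ∧
    -- and the multiplicities are as stated.
    (∀ ξ ∈ Ξ, ∀ (V : Type*) [AddCommGroup V] [Module ℂ V]
      (τ : Representation ℂ (S.Hstab ξ) V), τ.IsIrreducible →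
      (littleGroupRep (S.infl ξ) τ).IsIrreducible ∧
      multiplicity (littleGroupRep (S.infl ξ) τ) (permRep (SDP H A) S.Total) =
        ∑ θ : Θ, ∑ j : Fin (n θ + 1),
          if S.ConjugatePair ξ θ.1 τ (σ θ j) then m θ j else 0) ∧
    (∀ ξ ∈ Ξ,
      multiplicity (littleGroupRep (S.infl ξ) (Representation.trivial ℂ (S.Hstab ξ) ℂ))
        (permRep (SDP H A) S.Total) = (S.orbitClass Θ ξ).card) := by
  have hfin := fun θ j => finiteDimensional_of_isIrreducible (hirr θ j)
  have hX : Equivalent (permRep (SDP H A) S.Total)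
      (induced (S.KC y₀) (Representation.trivial ℂ (S.KC y₀) ℂ)) :=
    permRep_equivalent_induced _ (S.stabilizer_base y₀)
  have hsum : Equivalent (induced (S.KC y₀) (Representation.trivial ℂ (S.KC y₀) ℂ))
      (Representation.directSum
        (fun i : (Σ θ : Θ, Σ j : Fin (n θ + 1), Fin (m θ j)) =>
          littleGroupRep (S.infl i.1.1) (σ i.1 i.2.1))) :=
    induced_equivalent_directSum (fun θ : Θ => S.infl θ.1)
      (fun θ (i : Σ j : Fin (n θ + 1), Fin (m θ j)) => σ θ i.1) hdec
      (S.exists_charConj_infl hΘ) (S.sum_relIndex_Hstab hΘ)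
  refine ⟨hX, hsum, fun θ j => littleGroupRep_isIrreducible (hirr θ j), fun ξ _ V _ _ τ hτ =>
    ⟨littleGroupRep_isIrreducible hτ, S.multiplicity_littleGroupRep hirr (hX.trans hsum) hτ⟩,
    fun ξ _ => ?_⟩
  -- for trivial `τ`, only `j = 0` contributes, with `m θ 0 = 1`
  have htriv' : ∀ (θ : Θ) (j : Fin (n θ + 1)),
      Equivalent (Representation.trivial ℂ (S.Hstab θ.1) ℂ) (σ θ j) ↔ j = 0 :=
    fun θ j => ⟨fun h => (hineq θ 0 j ((htriv θ).trans h)).symm, by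
      rintro rfl
      exact (htriv θ).symm⟩
  have hm : ∀ θ : Θ, m θ 0 = 1 := fun θ =>
    multiplicity_of_trivial_eq_one (hirr θ) (hdec θ) (htriv' θ)
  refine (S.multiplicity_littleGroupRep hirr (hX.trans hsum) isIrreducible_trivial).trans ?_
  have hθ : ∀ θ : Θ, (∑ j, if S.ConjugatePair ξ θ.1
      (Representation.trivial ℂ (S.Hstab ξ) ℂ) (σ θ j) then m θ j else 0) =
      if θ.1 ∈ S.orbitClass Θ ξ then 1 else 0 := by
    intro θ
    simp [FiberSystem.conjugatePair_trivial_iff, FiberSystem.mem_orbitClass, htriv', ite_and, hm]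
  rw [Finset.sum_congr rfl fun θ _ => hθ θ, Finset.sum_coe_sort Θ
    fun θ => if θ ∈ S.orbitClass Θ ξ then 1 else 0, ← Finset.card_filter]
  congr 1
  ext θ
  rw [Finset.mem_filter, and_iff_right_iff_imp]
  exact fun h => (S.mem_orbitClass.1 h).1
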